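/- All posets are finite. A poset is graded (of rank $n$) if all its maximal chains have the same length $n$ (that is, $n+1$ elements); its rank function $\rho$ assigns to $x$ the length of the longest chain ending in $x$. A finite poset $P$ with least element $\hat 0$ and greatest element $\hat 1$ is called \emph{binomial} if every interval $[x,y]$ of $P$ is graded and any two intervals of the same rank have the same number of maximal chains. A graded poset is called \emph{Eulerian} if every interval $[x,y]$ with $x<y$ contains as many elements of even rank as elements of odd rank. Let $B_n$ be the poset of subsets of $\{1,\dots,n\}$ ordered by inclusion. Let $T_n$ (the butterfly poset of rank $n\ge 1$) be the poset on $\{\hat 0\}\cup(\{1,\dots,n-1\}\times\{1,2\})\cup\{\hat 1\}$ in which $\hat 0$ is the least element, $\hat 1$ is the greatest element, and $(a,i)<(b,j)$ if and only if $a<b$. For a poset $Q$ with $\hat 0$ and $\hat 1$ and a positive integer $k$, the $k$-summation $\boxplus^k(Q)$ is the poset obtained from the disjoint union of $k$ copies of $Q$ by identifying all the minimal elements $\hat 0$ with each other and all the maximal elements $\hat 1$ with each other. \textbf{Theorem.} Let $P$ be a finite Eulerian binomial poset of odd rank $n=2m+1\ge 5$. Then one of the following holds: (i) there is a positive integer $k$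 such that $P\cong\boxplus^k(B_n)$; (ii) there is a positive integer $k$ such that $P\cong\boxplus^k(T_n)$. -/

import Mathlib

namespace FinPoset

/-- `α` is graded of rank `n`: all maximal chains have length `n`, i.e. `n + 1` elements. -/
def HasRank (α : Type*) [PartialOrder α] (n : ℕ) : Prop :=
  ∀ C : Flag α, (C : Set α).ncard = n + 1

/-- `α` is graded: all maximal chains have the same length. -/
def IsGraded (α : Type*) [PartialOrder α] : Prop :=
  ∃ n : ℕ, HasRank α n

/-- The rank `ρ(x)` of an element: the length of the longest chain ending in `x`. In a finite
graded poset this is the rank function. -/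
noncomputable def rk {P : Type*} [PartialOrder P] (x : P) : ℕ :=
  (Order.height x).toNat

/-- The number of maximal chains of the interval `[x, y]`. -/
noncomputable def numMaxChains {P : Type*} [PartialOrder P] (x y : P) : ℕ :=
  Nat.card (Flag (Set.Icc x y))

/-- A finite poset with `⊥` and `⊤` is binomial if every interval is graded and any two intervals
of the same rank have the same number of maximal chains. -/
structure IsBinomial (P : Type*) [PartialOrder P] [BoundedOrder P] [Finite P] : Prop where
  graded : ∀ x y : P, x ≤ y → IsGraded (Set.Icc x y)
  numMaxChains_eq : ∀ (n : ℕ) (x y u v : P), x ≤ y → u ≤ v →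
    HasRank (Set.Icc x y) n → HasRank (Set.Icc u v) n →
    numMaxChains x y = numMaxChains u v

/-- A finite graded poset is Eulerian if every non-singleton interval has as many elements of even
rank as of odd rank. -/
structure IsEulerian (P : Type*) [PartialOrder P] [BoundedOrder P] [Finite P] : Prop where
  graded : IsGraded P
  euler_poincare : ∀ x y : P, x < y →
    {z : P | z ∈ Set.Icc x y ∧ Even (rk z)}.ncard = {z : P | z ∈ Set.Icc x y ∧ Odd (rk z)}.ncard

/-- The disjoint union of `k` copies of `P`. -/
@[ext]
structure Copies (k : ℕ) (P : Type*) where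
  copy : Fin k
  elt : P

/-- The preorder on `k` copies of `P` in which the order of each copy is kept, all copies of `⊥`
lie below everything and all copies of `⊤` lie above everything. -/
instance Copies.instPreorder (k : ℕ) (P : Type*) [PartialOrder P] [BoundedOrder P] :
    Preorder (Copies k P) where
  le a b := a.elt = ⊥ ∨ b.elt = ⊤ ∨ (a.copy = b.copy ∧ a.elt ≤ b.elt)
  le_refl a := Or.inr (Or.inr ⟨rfl, le_rfl⟩)
  le_trans a b c := by
    rintro (h | h | ⟨h, h'⟩) (g | g | ⟨g, g'⟩)
    · exact Or.inl h
    · exact Or.inl h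
    · exact Or.inl h
    · refine Or.inr (Or.inl (top_le_iff.1 ?_))
      rw [← h, g]
      exact bot_le
    · exact Or.inr (Or.inl g)
    · rw [h] at g'
      exact Or.inr (Or.inl (top_le_iff.1 g'))
    · rw [g] at h'
      exact Or.inl (le_bot_iff.1 h')
    · exact Or.inr (Or.inl g)
    · exact Or.inr (Or.inr ⟨h.trans g, h'.trans g'⟩)

/-- The `k`-summation of `P`: the poset obtained from `k` copies of `P` by identifying all the
minimal elements and all the maximal elements. -/
abbrev KSum (k : ℕ) (P : Type*) [PartialOrder P] [BoundedOrder P] : Type _ :=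
  Antisymmetrization (Copies k P) (· ≤ ·)

/-- Two elements of the disjoint union become equal in the `k`-summation exactly if they are
equal, both minimal or both maximal. -/
theorem KSum.mk_eq_iff {k : ℕ} {P : Type*} [PartialOrder P] [BoundedOrder P] [Nontrivial P]
    (a b : Copies k P) :
    toAntisymmetrization (· ≤ ·) a = toAntisymmetrization (· ≤ ·) b ↔
      a = b ∨ (a.elt = ⊥ ∧ b.elt = ⊥) ∨ (a.elt = ⊤ ∧ b.elt = ⊤) := by
  have key : toAntisymmetrization (· ≤ ·) a = toAntisymmetrization (· ≤ ·) b ↔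
      AntisymmRel (· ≤ ·) a b := Quotient.eq
  rw [key]
  constructor
  · rintro ⟨h | h | ⟨h, h'⟩, g | g | ⟨g, g'⟩⟩
    · exact Or.inr (Or.inl ⟨h, g⟩)
    · exact absurd (h.symm.trans g) bot_ne_top
    · rw [h] at g'
      exact Or.inr (Or.inl ⟨h, le_bot_iff.1 g'⟩)
    · exact absurd (g.symm.trans h) bot_ne_top
    · exact Or.inr (Or.inr ⟨g, h⟩)
    · rw [h] at g'
      exact Or.inr (Or.inr ⟨top_le_iff.1 g', h⟩)
    · rw [g] at h'
      exact Or.inr (Or.inl ⟨le_bot_iff.1 h', g⟩)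
    · rw [g] at h'
      exact Or.inr (Or.inr ⟨g, top_le_iff.1 h'⟩)
    · exact Or.inl (Copies.ext h (le_antisymm h' g'))
  · rintro (rfl | ⟨h, g⟩ | ⟨h, g⟩)
    · exact ⟨le_rfl, le_rfl⟩
    · exact ⟨Or.inl h, Or.inl g⟩
    · exact ⟨Or.inr (Or.inl g), Or.inr (Or.inl h)⟩

/-- The boolean lattice of rank `n`: the subsets of an `n`-element set, ordered by inclusion. -/
abbrev BooleanLattice (n : ℕ) : Type := Finset (Fin n)

/-- The proper part of the butterfly poset: `l` levels with two elements each. -/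
@[ext]
structure ButterflyCore (l : ℕ) where
  level : Fin l
  side : Fin 2

/-- Each element lies below both elements of every higher level, and the two elements of one level
are incomparable. -/
instance ButterflyCore.instPartialOrder (l : ℕ) : PartialOrder (ButterflyCore l) where
  le a b := a = b ∨ a.level < b.level
  le_refl a := Or.inl rfl
  le_trans a b c := by
    rintro (rfl | h) (rfl | g)
    · exact Or.inl rfl
    · exact Or.inr g
    · exact Or.inr h
    · exact Or.inr (h.trans g)
  le_antisymm a b := by
    rintro (h | h) (g | g)
    · exact h
    · exact h
    · exact g.symm
    · exact absurd g h.asymm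

/-- The butterfly poset `T_n` of rank `n ≥ 1`: two elements in each of the ranks `1, …, n - 1`,
together with a least and a greatest element. -/
abbrev Butterfly (n : ℕ) : Type := WithBot (WithTop (ButterflyCore (n - 1)))

end FinPoset

/-! Counting maximal chains through their second and their second-to-last elements shows that every
interval of rank `r > 0` has the same number `A r` of atoms and of coatoms
(`IsBinomial.exists_isCoverRegular`). Everything afterwards uses only these numbers and the Euler
relation.

Double counting of cover pairs expresses the sizes of the levels of an interval through `A`. Rank
two gives `A 2 = 2`. Rank four gives `A 4 * (4 - A 3) = 4`, so `(A 3, A 4)` is `(2, 2)` or `(3, 4)`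
(`A_three_four`). The first case propagates to `A i = 2` and the second to `A i = i`, two ranks at a
time. The Euler relation in rank `t + 4`, `t` even, is one equation in `A (t + 3)` and `A (t + 4)`,
which bounds `A (t + 3)` by 3 or `t + 3`. Divisibility of `A (t + 3)` by 2 or `t + 3` then fixes
both values (`A_butterfly_step`, `A_boolean_step`).

The divisibility comes from `Linked`: two atoms of `[u, v]` are related if they are equal or have a
common cover below `v`. If `A` is known up to `N` and `[u, v]` has rank `N + 1`, this is an
equivalence relation with classes of size `N + 1` in the Boolean case and 2 in the butterfly case.

In `P` itself, of rank `2 * m + 1`, the values of `A` are known up to `2 * m`; the last one stays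
free. The link classes of the atoms of `P` are the summands: the proper elements above a class,
together with `⊥` and `⊤`, form a Boolean lattice or a butterfly, and different classes have no
proper element above them in common. The number of classes is `k`. -/

namespace FinPoset

/-! ### Maximal chains of intervals, and counting them by atoms or coatoms. -/

section MaximalChains

variable {P : Type*} [PartialOrder P]

/-- `C` is a maximal chain of the interval `[x, y]`, as a set of elements of `P`. -/
structure IsMaxChainIn (x y : P) (C : Set P) : Prop where
  subset : C ⊆ Set.Icc x y
  total : ∀ a ∈ C, ∀ b ∈ C, a ≤ b ∨ b ≤ a
  maximal : ∀ z ∈ Set.Icc x y, (∀ c ∈ C, z ≤ c ∨ c ≤ z) → z ∈ C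

namespace IsMaxChainIn

variable {x y a b : P} {C : Set P}

theorem left_mem (h : IsMaxChainIn x y C) (hxy : x ≤ y) : x ∈ C :=
  h.maximal x ⟨le_rfl, hxy⟩ fun _ hc => Or.inl (h.subset hc).1

theorem right_mem (h : IsMaxChainIn x y C) (hxy : x ≤ y) : y ∈ C :=
  h.maximal y ⟨hxy, le_rfl⟩ fun _ hc => Or.inr (h.subset hc).2

theorem dual (h : IsMaxChainIn x y C) :
    IsMaxChainIn (P := Pᵒᵈ) (OrderDual.toDual y) (OrderDual.toDual x) (OrderDual.ofDual ⁻¹' C) where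
  subset _ hc := ⟨(h.subset hc).2, (h.subset hc).1⟩
  total _ ha _ hb := (h.total _ ha _ hb).symm
  maximal z hz hc := h.maximal z ⟨hz.2, hz.1⟩ fun c hc' => (hc c hc').symm

theorem insert_left (hax : x ⋖ a) (hay : a ≤ y) (h : IsMaxChainIn a y C) :
    IsMaxChainIn x y (insert x C) where
  subset := by
    rintro c (rfl | hc)
    · exact ⟨le_rfl, hax.le.trans hay⟩
    · exact ⟨hax.le.trans (h.subset hc).1, (h.subset hc).2⟩
  total := by
    rintro c (rfl | hc) d (rfl | hd)
    · exact Or.inl le_rfl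
    · exact Or.inl (hax.le.trans (h.subset hd).1)
    · exact Or.inr (hax.le.trans (h.subset hc).1)
    · exact h.total c hc d hd
  maximal := by
    intro z hz hzc
    rcases eq_or_lt_of_le hz.1 with rfl | hlt
    · exact Or.inl rfl
    refine Or.inr (h.maximal z ⟨?_, hz.2⟩ fun c hc => hzc c (Or.inr hc))
    rcases hzc a (Or.inr (h.left_mem hay)) with hza | haz
    · rcases eq_or_lt_of_le hza with rfl | hza
      · exact le_rfl
      · exact absurd hza (hax.2 hlt)
    · exact haz

/-- The least element of the chain after `x` must cover `x`: anything strictly between would be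
comparable to the whole chain. -/
theorem exists_diff_left [Finite P] (h : IsMaxChainIn x y C) (hxy : x < y) :
    ∃ a, x ⋖ a ∧ a ≤ y ∧ IsMaxChainIn a y (C \ {x}) := by
  obtain ⟨a, ha⟩ := (Set.toFinite (C \ {x})).exists_minimal
    ⟨y, h.right_mem hxy.le, fun hyx => hxy.ne' hyx⟩
  have hmin : ∀ c ∈ C \ {x}, a ≤ c := fun c hc =>
    (h.total a ha.1.1 c hc.1).elim id fun hca => ha.2 hc hca
  have hxa : x < a := lt_of_le_of_ne (h.subset ha.1.1).1 fun e => ha.1.2 e.symm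
  refine ⟨a, ⟨hxa, fun z hxz hza => ?_⟩, (h.subset ha.1.1).2, ⟨?_, ?_, ?_⟩⟩
  · have hz : z ∈ C := h.maximal z ⟨hxz.le, hza.le.trans (h.subset ha.1.1).2⟩ fun c hc => by
      by_cases hcx : c = x
      · exact Or.inr (hcx ▸ hxz.le)
      · exact Or.inl (hza.le.trans (hmin c ⟨hc, hcx⟩))
    exact hza.not_ge (hmin z ⟨hz, hxz.ne'⟩)
  · exact fun c hc => ⟨hmin c hc, (h.subset hc.1).2⟩
  · exact fun c hc d hd => h.total c hc.1 d hd.1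
  · intro z hz hzc
    refine ⟨h.maximal z ⟨hxa.le.trans hz.1, hz.2⟩ fun c hc => ?_, fun e => ?_⟩
    · by_cases hcx : c = x
      · exact Or.inr (hcx ▸ hxa.le.trans hz.1)
      · exact hzc c ⟨hc, hcx⟩
    · rw [Set.mem_singleton_iff] at e
      exact hxa.not_ge (e ▸ hz.1)

theorem left_notMem (hxa : x < a) (h : IsMaxChainIn a y C) : x ∉ C :=
  fun hx => hxa.not_ge (h.subset hx).1

theorem left_unique (hay : a ≤ y) (hby : b ≤ y) (ha : IsMaxChainIn a y C)
    (hb : IsMaxChainIn b y C) : a = b :=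
  le_antisymm (ha.subset (hb.left_mem hby)).1 (hb.subset (ha.left_mem hay)).1

theorem insert_right (hby : b ⋖ y) (hxb : x ≤ b) (h : IsMaxChainIn x b C) :
    IsMaxChainIn x y (insert y C) :=
  (insert_left (P := Pᵒᵈ) hby.toDual hxb h.dual).dual

end IsMaxChainIn

/-- Maximal chains of the interval `[x, y]` are its flags. -/
def flagIccEquiv (x y : P) : Flag (Set.Icc x y) ≃ {C : Set P // IsMaxChainIn x y C} where
  toFun F := ⟨Subtype.val '' (F : Set (Set.Icc x y)), {
    subset := by rintro _ ⟨c, -, rfl⟩; exact c.2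
    total := by
      rintro _ ⟨c, hc, rfl⟩ _ ⟨d, hd, rfl⟩
      exact F.le_or_le hc hd
    maximal := by
      intro z hz h
      have hins : IsChain (· ≤ ·) (insert ⟨z, hz⟩ (F : Set (Set.Icc x y))) :=
        F.chain_le.insert fun c hc _ => h c ⟨c, hc, rfl⟩
      have : (F : Set (Set.Icc x y)) = insert ⟨z, hz⟩ (F : Set (Set.Icc x y)) :=
        F.max_chain' hins (Set.subset_insert _ _)
      exact ⟨⟨z, hz⟩, this ▸ Set.mem_insert _ _, rfl⟩ }⟩
  invFun C :=
    { carrier := Subtype.val ⁻¹' C.1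
      Chain' := fun a ha b hb _ => C.2.total _ ha _ hb
      max_chain' := fun s hs hCs => by
        refine hCs.antisymm fun z hz => C.2.maximal z z.2 fun c hc => ?_
        exact hs.total hz (hCs (a := ⟨c, C.2.subset hc⟩) hc) }
  left_inv F := by
    ext z
    simp
  right_inv C := by
    ext z
    refine ⟨?_, fun h => ⟨⟨z, C.2.subset h⟩, h, rfl⟩⟩
    rintro ⟨c, hc, rfl⟩
    exact hc

theorem numMaxChains_eq_card (x y : P) :
    numMaxChains x y = Nat.card {C : Set P // IsMaxChainIn x y C} :=
  Nat.card_congr (flagIccEquiv x y)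

theorem hasRank_Icc_iff (x y : P) (n : ℕ) :
    HasRank (Set.Icc x y) n ↔ ∀ C : Set P, IsMaxChainIn x y C → C.ncard = n + 1 := by
  have key (F : Flag (Set.Icc x y)) : ((flagIccEquiv x y F).1).ncard =
      (F : Set (Set.Icc x y)).ncard := Set.ncard_image_of_injective _ Subtype.val_injective
  constructor
  · intro h C hC
    rw [← h ((flagIccEquiv x y).symm ⟨C, hC⟩), ← key, Equiv.apply_symm_apply]
  · intro h F
    rw [← key]
    exact h _ (flagIccEquiv x y F).2

theorem exists_isMaxChainIn (x y : P) : ∃ C, IsMaxChainIn x y C := by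
  obtain ⟨F⟩ : Nonempty (Flag (Set.Icc x y)) := inferInstance
  exact ⟨_, (flagIccEquiv x y F).2⟩

theorem numMaxChains_pos [Finite P] (x y : P) : 0 < numMaxChains x y := by
  rw [numMaxChains_eq_card]
  obtain ⟨C, hC⟩ := exists_isMaxChainIn x y
  have : Nonempty {C : Set P // IsMaxChainIn x y C} := ⟨⟨C, hC⟩⟩
  exact Nat.card_pos

theorem numMaxChains_dual (x y : P) :
    numMaxChains (P := Pᵒᵈ) (OrderDual.toDual y) (OrderDual.toDual x) = numMaxChains x y := by
  rw [numMaxChains_eq_card, numMaxChains_eq_card]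
  exact Nat.card_congr
    { toFun := fun C => ⟨OrderDual.toDual ⁻¹' C.1, C.2.dual⟩
      invFun := fun C => ⟨OrderDual.ofDual ⁻¹' C.1, C.2.dual⟩
      left_inv := fun _ => rfl
      right_inv := fun _ => rfl }

/-- A maximal chain of `[x, y]` consists of `x` and a maximal chain of `[a, y]` for a unique
cover `a` of `x`. -/
noncomputable def maxChainEquivSigma [Finite P] {x y : P} (hxy : x < y) :
    (Σ a : {a : P // x ⋖ a ∧ a ≤ y}, {C : Set P // IsMaxChainIn a.1 y C}) ≃
      {C : Set P // IsMaxChainIn x y C} :=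
  Equiv.ofBijective (fun p => ⟨insert x p.2.1, p.2.2.insert_left p.1.2.1 p.1.2.2⟩) <| by
    constructor
    · rintro ⟨⟨a, ha⟩, C, hC⟩ ⟨⟨b, hb⟩, D, hD⟩ h
      have h' : insert x C = insert x D := congrArg Subtype.val h
      have hCD : C = D := by
        rw [← Set.insert_sdiff_self_of_notMem (hC.left_notMem ha.1.lt), h',
          Set.insert_sdiff_self_of_notMem (hD.left_notMem hb.1.lt)]
      subst hCD
      obtain rfl := hC.left_unique ha.2 hb.2 hD
      rfl
    · rintro ⟨C, hC⟩
      obtain ⟨a, hxa, hay, ha⟩ := hC.exists_diff_left hxy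
      refine ⟨⟨⟨a, hxa, hay⟩, _, ha⟩, Subtype.ext ?_⟩
      simp [Set.insert_eq_of_mem (hC.left_mem hxy.le)]

/-- In a binomial poset the hypothesis holds for every interval, so the number of atoms is a
quotient of two chain counts and depends only on the rank. -/
theorem numMaxChains_eq_card_covers_mul [Finite P] {x y : P} (hxy : x < y) (N : ℕ)
    (hN : ∀ a, x ⋖ a → a ≤ y → numMaxChains a y = N) :
    numMaxChains x y = Nat.card {a : P // x ⋖ a ∧ a ≤ y} * N := by
  classical
  have := Fintype.ofFinite P
  rw [numMaxChains_eq_card, ← Nat.card_congr (maxChainEquivSigma hxy), Nat.card_sigma,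
    Finset.sum_congr rfl fun a _ => by
      rw [← numMaxChains_eq_card, hN a.1 a.2.1 a.2.2]]
  simp [Nat.card_eq_fintype_card]

theorem numMaxChains_eq_card_cocovers_mul [Finite P] {x y : P} (hxy : x < y) (N : ℕ)
    (hN : ∀ b, x ≤ b → b ⋖ y → numMaxChains x b = N) :
    numMaxChains x y = Nat.card {b : P // x ≤ b ∧ b ⋖ y} * N := by
  rw [← numMaxChains_dual, numMaxChains_eq_card_covers_mul (P := Pᵒᵈ) (x := OrderDual.toDual y)
    (y := OrderDual.toDual x) hxy N fun a ha ha' => by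
      rw [← hN (OrderDual.ofDual a) ha' ha.ofDual, ← numMaxChains_dual]; rfl]
  congr 1
  exact Nat.card_congr
    { toFun := fun a => ⟨OrderDual.ofDual a.1, a.2.2, a.2.1.ofDual⟩
      invFun := fun b => ⟨OrderDual.toDual b.1, b.2.2.toDual, b.2.1⟩
      left_inv := fun _ => rfl
      right_inv := fun _ => rfl }

end MaximalChains

theorem rk_bot {P : Type*} [PartialOrder P] [OrderBot P] : rk (⊥ : P) = 0 := by simp [rk]

/-! ### The height is a rank function, and rank differences are ranks of intervals. -/

section Rank

variable {P : Type*} [PartialOrder P] [BoundedOrder P] [Finite P]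

/-- The rank `d x` of `[⊥, x]` grows by one along covers. Hence `d` is strictly monotone, which
bounds the height above, and a saturated chain from `⊥` bounds it below. -/
theorem rk_eq_of_hasRank (hB : IsBinomial P) {x : P} {n : ℕ}
    (h : HasRank (Set.Icc ⊥ x) n) : Order.height x = n := by
  choose d hd using fun x : P => hB.graded ⊥ x bot_le
  have hcov : ∀ a b : P, a ⋖ b → d b = d a + 1 := by
    intro a b hab
    obtain ⟨C, hC⟩ := exists_isMaxChainIn ⊥ a
    have h1 := (hasRank_Icc_iff _ _ _).1 (hd a) C hC
    have h2 := (hasRank_Icc_iff _ _ _).1 (hd b) _ (hC.insert_right hab bot_le)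
    rw [Set.ncard_insert_of_notMem fun hb => hab.lt.not_ge (hC.subset hb).2] at h2
    omega
  have hmono : StrictMono d := by
    intro a b hab
    induction b using WellFoundedLT.induction with
    | ind b ih =>
      obtain ⟨c, hac, hcb⟩ := exists_le_covBy_of_lt hab
      rw [hcov c b hcb]
      rcases eq_or_lt_of_le hac with rfl | hac
      · omega
      · have := ih c hcb.lt hac
        omega
  have hle : ∀ x : P, (d x : ℕ∞) ≤ Order.height x := by
    intro x
    induction x using WellFoundedLT.induction with
    | ind x ih =>
      rcases eq_or_lt_of_le (bot_le : ⊥ ≤ x) with rfl | hx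
      · obtain ⟨C, hC⟩ := exists_isMaxChainIn (⊥ : P) ⊥
        have h1 := (hasRank_Icc_iff _ _ _).1 (hd ⊥) C hC
        have h2 : C.ncard ≤ 1 := by
          have := Set.ncard_le_ncard hC.subset
          simpa using this
        have : d ⊥ = 0 := by omega
        simp [this]
      · obtain ⟨c, -, hcx⟩ := exists_le_covBy_of_lt hx
        rw [hcov c x hcx]
        push_cast
        exact (add_le_add_left (ih c hcx.lt) 1).trans (Order.height_add_one_le hcx.lt)
  have hn : n = d x := by
    obtain ⟨C, hC⟩ := exists_isMaxChainIn ⊥ x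
    have h1 := (hasRank_Icc_iff _ _ _).1 (hd x) C hC
    have h2 := (hasRank_Icc_iff _ _ _).1 h C hC
    omega
  rw [hn]
  refine le_antisymm ?_ (hle x)
  have := Order.height_le_height_apply_of_strictMono d hmono x
  simpa using this

theorem rk_covBy (hB : IsBinomial P) {a b : P} (hab : a ⋖ b) : rk b = rk a + 1 := by
  obtain ⟨m, hm⟩ := hB.graded ⊥ a bot_le
  obtain ⟨n, hn⟩ := hB.graded ⊥ b bot_le
  rw [rk, rk, rk_eq_of_hasRank hB hm, rk_eq_of_hasRank hB hn]
  obtain ⟨C, hC⟩ := exists_isMaxChainIn ⊥ a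
  have h1 := (hasRank_Icc_iff _ _ _).1 hm C hC
  have h2 := (hasRank_Icc_iff _ _ _).1 hn _ (hC.insert_right hab bot_le)
  rw [Set.ncard_insert_of_notMem fun hb => hab.lt.not_ge (hC.subset hb).2] at h2
  simp only [ENat.toNat_natCast]
  omega

theorem rk_top (hB : IsBinomial P) {n : ℕ} (h : HasRank P n) : rk (⊤ : P) = n := by
  have : HasRank (Set.Icc (⊥ : P) ⊤) n := by
    refine (hasRank_Icc_iff _ _ _).2 fun C hC => ?_
    exact h ⟨C, fun a ha b hb _ => hC.total a ha b hb, fun s hs hCs => hCs.antisymm fun z hz =>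
      hC.maximal z ⟨bot_le, le_top⟩ fun c hc => hs.total hz (hCs hc)⟩
  rw [rk, rk_eq_of_hasRank hB this, ENat.toNat_natCast]

theorem hasRank_Icc (hB : IsBinomial P) {r : ℕ} {x y : P} (hxy : x ≤ y)
    (hr : rk y = rk x + r) : HasRank (Set.Icc x y) r := by
  rw [hasRank_Icc_iff]
  induction r generalizing x with
  | zero =>
    intro C hC
    have hyx : x = y := by
      rcases eq_or_lt_of_le hxy with h | h
      · exact h
      obtain ⟨c, hxc, hcy⟩ := exists_covBy_le_of_lt h
      have h1 := rk_covBy hB hxc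
      have h2 : rk c ≤ rk y := ENat.toNat_le_toNat (Order.height_mono hcy) <| by
        obtain ⟨n, hn⟩ := hB.graded ⊥ y bot_le
        simp [rk_eq_of_hasRank hB hn]
      omega
    subst hyx
    have : C = {x} := by
      refine Set.Subset.antisymm (by simpa using hC.subset) ?_
      simpa using hC.left_mem le_rfl
    simp [this]
  | succ r ih =>
    intro C hC
    have hlt : x < y := lt_of_le_of_ne hxy (by rintro rfl; omega)
    obtain ⟨a, hxa, hay, ha⟩ := hC.exists_diff_left hlt
    have := ih hay (by rw [rk_covBy hB hxa]; omega) _ ha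
    rw [Set.ncard_sdiff_singleton_of_mem (hC.left_mem hxy)] at this
    omega

end Rank

end FinPoset

namespace FinPoset

theorem lt_of_le_of_apply_lt {P : Type*} [PartialOrder P] {ρ : P → ℕ} {x y : P} (hxy : x ≤ y)
    (hr : ρ x < ρ y) : x < y :=
  lt_of_le_of_ne hxy (by rintro rfl; omega)

/-! ### Level sizes, and the numbers of atoms in ranks up to four. -/

section Counting

variable {P : Type*} [PartialOrder P] [Fintype P]

open scoped Classical in
/-- The covers of `x` below `y`. -/
noncomputable def covers (x y : P) : Finset P := {a | x ⋖ a ∧ a ≤ y}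

open scoped Classical in
/-- The elements above `x` covered by `y`. -/
noncomputable def cocovers (x y : P) : Finset P := {b | x ≤ b ∧ b ⋖ y}

open scoped Classical in
/-- The elements of `[x, y]` whose rank exceeds the rank of `x` by `i`. -/
noncomputable def level (ρ : P → ℕ) (x y : P) (i : ℕ) : Finset P :=
  {z | x ≤ z ∧ z ≤ y ∧ ρ z = ρ x + i}

@[simp]
theorem mem_covers {x y a : P} : a ∈ covers x y ↔ x ⋖ a ∧ a ≤ y := by simp [covers]

@[simp]
theorem mem_cocovers {x y b : P} : b ∈ cocovers x y ↔ x ≤ b ∧ b ⋖ y := by simp [cocovers]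

@[simp]
theorem mem_level {ρ : P → ℕ} {x y z : P} {i : ℕ} :
    z ∈ level ρ x y i ↔ x ≤ z ∧ z ≤ y ∧ ρ z = ρ x + i := by simp [level]

/-- A finite poset graded by `ρ` in which every interval of rank `r > 0` has `A r` atoms and `A r`
coatoms, and in which every nontrivial interval satisfies the Euler relation. -/
structure IsCoverRegular (ρ : P → ℕ) (A : ℕ → ℕ) : Prop where
  rank_covBy : ∀ {a b : P}, a ⋖ b → ρ b = ρ a + 1
  card_covers : ∀ {x y : P} {r : ℕ}, x ≤ y → ρ y = ρ x + r → 0 < r → (covers x y).card = A r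
  card_cocovers : ∀ {x y : P} {r : ℕ}, x ≤ y → ρ y = ρ x + r → 0 < r → (cocovers x y).card = A r
  euler : ∀ {x y : P} {r : ℕ}, x ≤ y → ρ y = ρ x + r → 0 < r →
    ∑ i ∈ Finset.range (r + 1), (-1 : ℤ) ^ i * (level ρ x y i).card = 0

namespace IsCoverRegular

variable {ρ : P → ℕ} {A : ℕ → ℕ} (h : IsCoverRegular ρ A) {x y z : P} {r i : ℕ}
include h

theorem rank_lt (hxy : x < y) : ρ x < ρ y := by
  induction y using WellFoundedLT.induction with
  | ind y ih =>
    obtain ⟨c, hxc, hcy⟩ := exists_le_covBy_of_lt hxy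
    rw [h.rank_covBy hcy]
    rcases eq_or_lt_of_le hxc with rfl | hxc
    · omega
    · have := ih c hcy.lt hxc
      omega

theorem rank_le (hxy : x ≤ y) : ρ x ≤ ρ y := by
  rcases eq_or_lt_of_le hxy with rfl | hxy
  · exact le_rfl
  · exact (h.rank_lt hxy).le

theorem eq_of_rank_le (hxy : x ≤ y) (hr : ρ y ≤ ρ x) : x = y :=
  (eq_or_lt_of_le hxy).resolve_right fun hlt => (h.rank_lt hlt).not_ge hr

theorem covBy_of_rank (hxy : x ≤ y) (hr : ρ y = ρ x + 1) : x ⋖ y :=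
  ⟨lt_of_le_of_apply_lt (ρ := ρ) hxy (by omega), fun _ hxz hzy => by
    have := h.rank_lt hxz
    have := h.rank_lt hzy
    omega⟩

theorem level_zero (hxy : x ≤ y) : level ρ x y 0 = {x} := by
  ext z
  simp only [mem_level, Finset.mem_singleton]
  constructor
  · rintro ⟨hxz, -, hz⟩
    exact (h.eq_of_rank_le hxz (by omega)).symm
  · rintro rfl
    exact ⟨le_rfl, hxy, rfl⟩

theorem level_self (hxy : x ≤ y) (hr : ρ y = ρ x + r) : level ρ x y r = {y} := by
  ext z
  simp only [mem_level, Finset.mem_singleton]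
  constructor
  · rintro ⟨-, hzy, hz⟩
    exact h.eq_of_rank_le hzy (by omega)
  · rintro rfl
    exact ⟨hxy, le_rfl, hr⟩

theorem level_one : level ρ x y 1 = covers x y := by
  ext z
  simp only [mem_level, mem_covers]
  constructor
  · rintro ⟨hxz, hzy, hz⟩
    exact ⟨h.covBy_of_rank hxz hz, hzy⟩
  · rintro ⟨hxz, hzy⟩
    exact ⟨hxz.le, hzy, h.rank_covBy hxz⟩

theorem level_pred (hr : ρ y = ρ x + (r + 1)) : level ρ x y r = cocovers x y := by
  ext z
  simp only [mem_level, mem_cocovers]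
  constructor
  · rintro ⟨hxz, hzy, hz⟩
    exact ⟨hxz, h.covBy_of_rank hzy (by omega)⟩
  · rintro ⟨hxz, hzy⟩
    exact ⟨hxz, hzy.le, by have := h.rank_covBy hzy; omega⟩

/-- Both sides count the cover pairs between levels `i` and `i + 1`, by lower and by upper end. -/
theorem card_level_mul (hr : ρ y = ρ x + r) (hi : i < r) :
    (level ρ x y i).card * A (r - i) = (level ρ x y (i + 1)).card * A (i + 1) := by
  classical
  refine Finset.card_mul_eq_card_mul (r := fun a b => a ⋖ b) ?_ ?_
  · intro a ha
    rw [mem_level] at ha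
    rw [← h.card_covers (x := a) (y := y) (r := r - i) ha.2.1 (by omega) (by omega)]
    congr 1
    ext b
    simp only [Finset.mem_bipartiteAbove, mem_level, mem_covers]
    constructor
    · rintro ⟨⟨-, hby, -⟩, hab⟩
      exact ⟨hab, hby⟩
    · rintro ⟨hab, hby⟩
      exact ⟨⟨ha.1.trans hab.le, hby, by rw [h.rank_covBy hab]; omega⟩, hab⟩
  · intro b hb
    rw [mem_level] at hb
    rw [← h.card_cocovers (x := x) (y := b) (r := i + 1) hb.1 (by omega) (by omega)]
    congr 1
    ext a
    simp only [Finset.mem_bipartiteBelow, mem_level, mem_cocovers]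
    constructor
    · rintro ⟨⟨hxa, -, -⟩, hab⟩
      exact ⟨hxa, hab⟩
    · rintro ⟨hxa, hab⟩
      exact ⟨⟨hxa, hab.le.trans hb.2.1, by have := h.rank_covBy hab; omega⟩, hab⟩

theorem level_nonempty (hxy : x ≤ y) (hr : ρ y = ρ x + r) (hi : i ≤ r) :
    (level ρ x y i).Nonempty := by
  induction i with
  | zero => exact ⟨x, by simp [hxy]⟩
  | succ i ih =>
    obtain ⟨z, hz⟩ := ih (by omega)
    rw [mem_level] at hz
    obtain ⟨c, hzc, hcy⟩ := exists_covBy_le_of_lt (lt_of_le_of_apply_lt (ρ := ρ) hz.2.1 (by omega))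
    exact ⟨c, by rw [mem_level]; exact ⟨hz.1.trans hzc.le, hcy, by rw [h.rank_covBy hzc]; omega⟩⟩

theorem A_pos (hxy : x ≤ y) (hr : ρ y = ρ x + r) (hr0 : 0 < r) : 0 < A r := by
  rw [← h.card_covers hxy hr hr0, ← h.level_one, Finset.card_pos]
  exact h.level_nonempty hxy hr hr0

theorem A_one (hxy : x ≤ y) (hr : ρ y = ρ x + r) (hr0 : 0 < r) : A 1 = 1 := by
  obtain ⟨a, ha⟩ := h.level_nonempty hxy hr (i := 1) hr0
  rw [mem_level] at ha
  rw [← h.card_covers ha.1 ha.2.2 one_pos, ← h.level_one, h.level_self ha.1 ha.2.2,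
    Finset.card_singleton]

/-- The atoms below a coatom are among all atoms. -/
theorem A_le_succ (hxy : x ≤ y) (hr : ρ y = ρ x + (r + 1)) (hr0 : 0 < r) : A r ≤ A (r + 1) := by
  obtain ⟨b, hb⟩ := h.level_nonempty hxy hr (i := r) (by omega)
  rw [mem_level] at hb
  rw [← h.card_covers hb.1 hb.2.2 hr0, ← h.card_covers hxy hr (by omega)]
  refine Finset.card_le_card fun a ha => ?_
  rw [mem_covers] at ha ⊢
  exact ⟨ha.1, ha.2.trans hb.2.1⟩

/-- In an interval of rank two, the Euler relation forces two atoms. -/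
theorem A_two (hxy : x ≤ y) (hr : ρ y = ρ x + r) (hr0 : 2 ≤ r) : A 2 = 2 := by
  obtain ⟨z, hz⟩ := h.level_nonempty hxy hr (i := 2) hr0
  rw [mem_level] at hz
  have := h.euler hz.1 hz.2.2 (by omega)
  simp only [Finset.sum_range_succ, Finset.sum_range_zero, h.level_zero hz.1, h.level_one,
    h.level_self hz.1 hz.2.2, h.card_covers hz.1 hz.2.2 (by omega)] at this
  simp only [Finset.card_singleton] at this
  push_cast at this
  omega

theorem A_three_four (hxy : x ≤ y) (hr : ρ y = ρ x + r) (hr0 : 4 ≤ r) :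
    (A 3 = 2 ∧ A 4 = 2) ∨ (A 3 = 3 ∧ A 4 = 4) := by
  have h2 := h.A_two hxy hr (by omega)
  obtain ⟨z, hz⟩ := h.level_nonempty hxy hr (i := 4) hr0
  rw [mem_level] at hz
  obtain ⟨hxz, -, hz⟩ := hz
  have he := h.euler hxz hz (by omega)
  have hm := h.card_level_mul hz (i := 1) (by omega)
  have h3 := h.A_pos hxz hz (by omega)
  obtain ⟨w, hw⟩ := h.level_nonempty hxz hz (i := 3) (by omega)
  rw [mem_level] at hw
  have h23 : A 2 ≤ A 3 := h.A_le_succ hw.1 hw.2.2 (by omega)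
  rw [h.level_one, h.card_covers hxz hz (by omega), h2] at hm
  simp only [Finset.sum_range_succ, Finset.sum_range_zero, h.level_zero hxz, h.level_one,
    h.level_self hxz hz, h.card_covers hxz hz (by omega), h.level_pred (r := 3) hz,
    h.card_cocovers hxz hz (by omega), Finset.card_singleton] at he
  push_cast at he
  norm_num at hm he
  zify at hm
  -- The middle level has `A 4 * A 3 / 2` elements; this is substituted into the Euler relation.
  have key : (A 4 : ℤ) * (4 - A 3) = 4 := by linarith
  have h4 : (A 3 : ℤ) < 4 := by
    by_contra hc
    have : (A 4 : ℤ) * (4 - A 3) ≤ 0 :=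
      mul_nonpos_of_nonneg_of_nonpos (by positivity) (by linarith)
    omega
  have h5 : A 3 = 2 ∨ A 3 = 3 := by omega
  rcases h5 with h5 | h5
  · left
    rw [h5] at key
    push_cast at key
    omega
  · right
    rw [h5] at key
    push_cast at key
    omega

end IsCoverRegular

end Counting

/-! ### From binomial and Eulerian posets to cover regularity. -/

theorem IsBinomial.exists_isCoverRegular {P : Type*} [PartialOrder P] [BoundedOrder P] [Fintype P]
    (hB : IsBinomial P) (hE : IsEulerian P) : ∃ A : ℕ → ℕ, IsCoverRegular (rk (P := P)) A := by
  classical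
  have hex : ∀ r : ℕ, ∃ B : ℕ, 0 < B ∧ ∀ x y : P, x ≤ y → rk y = rk x + r →
      numMaxChains x y = B := by
    intro r
    by_cases hr : ∃ x y : P, x ≤ y ∧ rk y = rk x + r
    · obtain ⟨u, v, huv, hr⟩ := hr
      exact ⟨numMaxChains u v, numMaxChains_pos u v, fun x y hxy hr' =>
        hB.numMaxChains_eq r x y u v hxy huv (hasRank_Icc hB hxy hr') (hasRank_Icc hB huv hr)⟩
    · push Not at hr
      -- No interval has this rank; the value 1 only keeps `B` positive.
      exact ⟨1, one_pos, fun x y hxy hr' => absurd hr' (hr x y hxy)⟩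
  choose B hB0 hB' using hex
  refine ⟨fun r => B r / B (r - 1), fun hab => rk_covBy hB hab, ?_, ?_, ?_⟩
  · intro x y r hxy hr hr0
    have hlt : x < y := lt_of_le_of_ne hxy (by rintro rfl; omega)
    have := numMaxChains_eq_card_covers_mul hlt (B (r - 1)) fun a hxa hay =>
      hB' _ _ _ hay (by rw [rk_covBy hB hxa]; omega)
    rw [hB' r x y hxy hr] at this
    rw [this, Nat.mul_div_cancel _ (hB0 _), Nat.card_eq_fintype_card, Fintype.card_subtype]
    rfl
  · intro x y r hxy hr hr0
    have hlt : x < y := lt_of_le_of_ne hxy (by rintro rfl; omega)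
    have := numMaxChains_eq_card_cocovers_mul hlt (B (r - 1)) fun b hxb hby =>
      hB' _ _ _ hxb (by have := rk_covBy hB hby; omega)
    rw [hB' r x y hxy hr] at this
    rw [this, Nat.mul_div_cancel _ (hB0 _), Nat.card_eq_fintype_card, Fintype.card_subtype]
    rfl
  · intro x y r hxy hr hr0
    have hlt : x < y := lt_of_le_of_ne hxy (by rintro rfl; omega)
    have hmono : Monotone (rk (P := P)) := fun a b hab => by
      obtain ⟨n, hn⟩ := hB.graded ⊥ b bot_le
      exact ENat.toNat_le_toNat (Order.height_mono hab) (by simp [rk_eq_of_hasRank hB hn])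
    set s : Finset P := {z | x ≤ z ∧ z ≤ y} with hs
    have hsum : ∑ z ∈ s, (-1 : ℤ) ^ rk z = 0 := by
      have he := hE.euler_poincare x y hlt
      have h1 : {z : P | z ∈ Set.Icc x y ∧ Even (rk z)} =
          ((s.filter fun z => Even (rk z) : Finset P) : Set P) := by ext z; simp [hs]
      have h2 : {z : P | z ∈ Set.Icc x y ∧ Odd (rk z)} =
          ((s.filter fun z => ¬ Even (rk z) : Finset P) : Set P) := by ext z; simp [hs]
      rw [h1, h2, Set.ncard_coe_finset, Set.ncard_coe_finset] at he
      rw [← Finset.sum_filter_add_sum_filter_not s fun z => Even (rk z),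
        Finset.sum_congr rfl fun z hz => (Finset.mem_filter.1 hz).2.neg_one_pow,
        Finset.sum_congr (rfl : s.filter (fun z => ¬ Even (rk z)) = _) fun z hz =>
          (Nat.not_even_iff_odd.1 (Finset.mem_filter.1 hz).2).neg_one_pow]
      simp [he]
    have hmaps : ∀ z ∈ s, rk z - rk x ∈ Finset.range (r + 1) := by
      intro z hz
      have hz' : x ≤ z ∧ z ≤ y := by simpa [hs] using hz
      have := hmono hz'.2
      rw [Finset.mem_range]
      omega
    -- Grouping by rank above `x` turns the signed sum into the level form, up to the global sign
    -- `(-1) ^ rk x`.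
    rw [← Finset.sum_fiberwise_of_maps_to hmaps] at hsum
    have hfib : ∀ i ∈ Finset.range (r + 1),
        ∑ z ∈ s.filter (fun z => rk z - rk x = i), (-1 : ℤ) ^ rk z =
          (-1) ^ rk x * ((-1 : ℤ) ^ i * (level rk x y i).card) := by
      intro i _
      have hlev : s.filter (fun z => rk z - rk x = i) = level rk x y i := by
        ext z
        simp only [hs, Finset.mem_filter, Finset.mem_univ, true_and, mem_level]
        constructor
        · rintro ⟨⟨hxz, hzy⟩, hz⟩
          have := hmono hxz
          exact ⟨hxz, hzy, by omega⟩
        · rintro ⟨hxz, hzy, hz⟩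
          exact ⟨⟨hxz, hzy⟩, by omega⟩
      rw [hlev, Finset.sum_congr rfl fun z hz => by rw [(mem_level.1 hz).2.2]]
      rw [Finset.sum_const, nsmul_eq_mul, pow_add]
      ring
    rw [Finset.sum_congr rfl hfib, ← Finset.mul_sum] at hsum
    exact (mul_eq_zero.1 hsum).resolve_left (pow_ne_zero _ (by norm_num))

end FinPoset

/-! ### Common covers of atoms and the relation of being linked. -/

namespace FinPoset

/-- `a` and `b` are equal or have a common cover below `v`. -/
def Linked {P : Type*} [PartialOrder P] (v a b : P) : Prop :=
  a = b ∨ ∃ e ≤ v, a ⋖ e ∧ b ⋖ e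

theorem Linked.symm {P : Type*} [PartialOrder P] {v a b : P} (h : Linked v a b) :
    Linked v b a := by
  rcases h with rfl | ⟨e, hev, ha, hb⟩
  · exact Or.inl rfl
  · exact Or.inr ⟨e, hev, hb, ha⟩

namespace IsCoverRegular

variable {P : Type*} [PartialOrder P] [Fintype P]
variable {ρ : P → ℕ} {A : ℕ → ℕ} (h : IsCoverRegular ρ A) {u v a b c e f g z w : P} {s N : ℕ}
include h

theorem card_covers_of_covBy_covBy (h2 : A 2 = 2) (ha : u ⋖ a) (he : a ⋖ e) :
    (covers u e).card = 2 := by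
  rw [h.card_covers (ha.le.trans he.le) (r := 2) _ (by omega), h2]
  rw [h.rank_covBy he, h.rank_covBy ha]

theorem exists_other_cover (h2 : A 2 = 2) (ha : u ⋖ a) (he : a ⋖ e) :
    ∃ b, b ≠ a ∧ u ⋖ b ∧ b ⋖ e := by
  obtain ⟨b, hb, hne⟩ := Finset.exists_mem_ne
    (by rw [h.card_covers_of_covBy_covBy h2 ha he]; omega) a
  rw [mem_covers] at hb
  refine ⟨b, hne, hb.1, h.covBy_of_rank hb.2 ?_⟩
  rw [h.rank_covBy he, h.rank_covBy ha, h.rank_covBy hb.1]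

theorem eq_or_eq_of_covBy (h2 : A 2 = 2) (hab : a ≠ b) (ha : u ⋖ a) (hb : u ⋖ b) (hae : a ⋖ e)
    (hbe : b ⋖ e) (hc : u ⋖ c) (hce : c ≤ e) : c = a ∨ c = b := by
  classical
  have hsub : ({a, b} : Finset P) ⊆ covers u e := by
    intro d hd
    rw [Finset.mem_insert, Finset.mem_singleton] at hd
    rw [mem_covers]
    rcases hd with rfl | rfl
    · exact ⟨ha, hae.le⟩
    · exact ⟨hb, hbe.le⟩
  have heq := Finset.eq_of_subset_of_card_le hsub
    (by rw [h.card_covers_of_covBy_covBy h2 ha hae, Finset.card_pair hab])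
  have hc' : c ∈ ({a, b} : Finset P) := by rw [heq, mem_covers]; exact ⟨hc, hce⟩
  simpa using hc'

/-- In an interval of rank three with three atoms, two coatoms cannot share two atoms. -/
theorem eq_of_covBy_of_common_cover (h2 : A 2 = 2) (h3 : A 3 = 3) (hab : a ≠ b) (ha : u ⋖ a)
    (hb : u ⋖ b) (hae : a ⋖ e) (hbe : b ⋖ e) (haf : a ⋖ f) (hbf : b ⋖ f) (heg : e ⋖ g)
    (hfg : f ⋖ g) : e = f := by
  classical
  by_contra hef
  have hug : u ≤ g := ha.le.trans (hae.le.trans heg.le)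
  have hrank : ρ g = ρ u + 3 := by rw [h.rank_covBy heg, h.rank_covBy hae, h.rank_covBy ha]
  have hcard := h.card_cocovers hug hrank (by omega)
  -- A third coatom `d`. An atom below both `e` and `f` already has its two coatoms, so it is not
  -- below `d`; this excludes `a` and `b` and leaves `d` at most one atom instead of two.
  obtain ⟨d, hd, hd'⟩ := Finset.exists_mem_notMem_of_card_lt_card
    (s := {e, f}) (t := cocovers u g) (by rw [Finset.card_pair hef]; omega)
  simp only [Finset.mem_insert, Finset.mem_singleton, not_or, mem_cocovers] at hd hd'
  have hrd := h.rank_covBy hd.2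
  have hno : ∀ x, u ⋖ x → x ⋖ e → x ⋖ f → ¬ x ≤ d := by
    intro x hux hxe hxf hxd
    have hxd' : x ⋖ d := h.covBy_of_rank hxd (by rw [h.rank_covBy hux]; omega)
    have hle : ({e, f, d} : Finset P).card ≤ (covers x g).card := by
      refine Finset.card_le_card fun y hy => ?_
      simp only [Finset.mem_insert, Finset.mem_singleton] at hy
      rw [mem_covers]
      rcases hy with rfl | rfl | rfl
      · exact ⟨hxe, heg.le⟩
      · exact ⟨hxf, hfg.le⟩
      · exact ⟨hxd', hd.2.le⟩
    rw [h.card_covers_of_covBy_covBy h2 hxe heg, Finset.card_eq_three.2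
      ⟨e, f, d, hef, Ne.symm hd'.1, Ne.symm hd'.2, rfl⟩] at hle
    omega
  have hsub : (covers u d) ⊆ (covers u g) \ {a, b} := by
    intro x hx
    rw [mem_covers] at hx
    simp only [Finset.mem_sdiff, mem_covers, Finset.mem_insert, Finset.mem_singleton, not_or]
    refine ⟨⟨hx.1, hx.2.trans hd.2.le⟩, ?_, ?_⟩
    · rintro rfl
      exact hno x ha hae haf hx.2
    · rintro rfl
      exact hno x hb hbe hbf hx.2
  have hle := Finset.card_le_card hsub
  rw [Finset.card_sdiff_of_subset (by
    intro x hx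
    simp only [Finset.mem_insert, Finset.mem_singleton] at hx
    rw [mem_covers]
    rcases hx with rfl | rfl
    · exact ⟨ha, hae.le.trans heg.le⟩
    · exact ⟨hb, hbe.le.trans heg.le⟩), Finset.card_pair hab,
    h.card_covers hug hrank (by omega), h.card_covers hd.1 (r := 2) (by omega) (by omega)] at hle
  omega

/-! ### Linked atoms when `A i = i` for `1 ≤ i ≤ N`. -/

section Boolean

variable (hA : ∀ i, 1 ≤ i → i ≤ N → A i = i) (hN : 3 ≤ N)
include hA hN

/-- Two atoms of an interval of small rank have a common cover. -/
theorem exists_common_cover (hs : s ≤ N) (hr : ρ v = ρ u + s) (hab : a ≠ b) (ha : u ⋖ a)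
    (hav : a ≤ v) (hb : u ⋖ b) (hbv : b ≤ v) : ∃ w ≤ v, a ⋖ w ∧ b ⋖ w := by
  classical
  have h2 : A 2 = 2 := hA 2 (by omega) (by omega)
  have h3 : A 3 = 3 := hA 3 (by omega) (by omega)
  induction s generalizing u a b with
  | zero =>
    have := h.rank_le hav
    have := h.rank_covBy ha
    omega
  | succ s ih =>
    have hra := h.rank_covBy ha
    have huv := ha.le.trans hav
    have hcard := h.card_covers huv hr (by omega)
    rw [hA _ (by omega) hs] at hcard
    rcases Nat.eq_zero_or_pos s with rfl | hs0
    · exact absurd (Finset.card_le_one.1 hcard.le a (by simp [ha, hav]) b (by simp [hb, hbv])) hab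
    have hcard' := h.card_covers hav (r := s) (by omega) hs0
    rw [hA _ (by omega) (by omega)] at hcard'
    -- `o e` is the atom below `e` other than `a`. It is injective on the `s` covers of `a`, and
    -- there are `s` atoms other than `a`, so `b` is attained.
    choose! o ho using fun e => h.exists_other_cover (e := e) h2 ha
    have hinj : Set.InjOn o (covers a v) := by
      intro e he f hf hef
      rw [Finset.mem_coe, mem_covers] at he hf
      by_contra hne
      -- The induction hypothesis in `[a, v]` places `e` and `f` in an interval of rank three, where
      -- they cannot share two atoms.
      obtain ⟨g, hgv, heg, hfg⟩ := ih (by omega) (by omega) hne he.1 he.2 hf.1 hf.2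
      have hoe := ho e he.1
      have hof := ho f hf.1
      rw [← hef] at hof
      exact hne (h.eq_of_covBy_of_common_cover h2 h3 hoe.1.symm ha hoe.2.1 he.1 hoe.2.2 hf.1
        hof.2.2 heg hfg)
    have himg : (covers a v).image o = (covers u v).erase a := by
      refine Finset.eq_of_subset_of_card_le ?_ ?_
      · intro x hx
        rw [Finset.mem_image] at hx
        obtain ⟨e, he, rfl⟩ := hx
        rw [mem_covers] at he
        have hoe := ho e he.1
        rw [Finset.mem_erase, mem_covers]
        exact ⟨hoe.1, hoe.2.1, hoe.2.2.le.trans he.2⟩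
      · rw [Finset.card_image_of_injOn hinj, Finset.card_erase_of_mem (by simp [ha, hav])]
        omega
    have hbm : b ∈ (covers a v).image o := by
      rw [himg, Finset.mem_erase, mem_covers]
      exact ⟨hab.symm, hb, hbv⟩
    rw [Finset.mem_image] at hbm
    obtain ⟨e, he, rfl⟩ := hbm
    rw [mem_covers] at he
    exact ⟨e, he.2, he.1, (ho e he.1).2.2⟩

theorem common_cover_unique (hs : s ≤ N + 1) (hr : ρ v = ρ u + s) (hab : a ≠ b) (ha : u ⋖ a)
    (hb : u ⋖ b) (hae : a ⋖ e) (hbe : b ⋖ e) (haf : a ⋖ f) (hbf : b ⋖ f) (hev : e ≤ v)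
    (hfv : f ≤ v) : e = f := by
  by_contra hne
  have hra := h.rank_covBy ha
  have hav := h.rank_le (hae.le.trans hev)
  obtain ⟨g, hgv, heg, hfg⟩ := h.exists_common_cover hA hN (s := s - 1) (u := a) (v := v)
    (by omega) (by omega) hne hae hev haf hfv
  exact hne (h.eq_of_covBy_of_common_cover (hA 2 (by omega) (by omega))
    (hA 3 (by omega) (by omega)) hab ha hb hae hbe haf hbf heg hfg)

/-- The inclusion of atoms passes from `u` to an atom `a ≤ z`: a cover `e ≤ z` of `a` is the unique
common cover of `a` and a second atom, and these two atoms have a common cover below `w`. Induction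
applies above `a`. -/
theorem le_of_covers_le (hs : s ≤ N + 1) (hr : ρ v = ρ u + s) (huz : u ≤ z) (hzv : z ≤ v)
    (huw : u ≤ w) (hwv : w ≤ v) (hzw : ∀ a, u ⋖ a → a ≤ z → a ≤ w) : z ≤ w := by
  induction s generalizing u with
  | zero =>
    obtain rfl := h.eq_of_rank_le (huz.trans hzv) (by omega)
    exact hzv.trans huw
  | succ s ih =>
    rcases eq_or_lt_of_le huz with rfl | hlt
    · exact huw
    obtain ⟨a, ha, haz⟩ := exists_covBy_le_of_lt hlt
    have hra := h.rank_covBy ha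
    refine ih (by omega) (by omega) haz (hzw a ha haz) fun e hae hez => ?_
    -- The case `w = v` is separate because common covers exist only in rank at most `N`.
    rcases eq_or_lt_of_le hwv with rfl | hwv'
    · exact hez.trans hzv
    obtain ⟨b, hba, hb, hbe⟩ := h.exists_other_cover (hA 2 (by omega) (by omega)) ha hae
    have hrw := h.rank_lt hwv'
    have hrw' := h.rank_le huw
    obtain ⟨f, hfw, haf, hbf⟩ := h.exists_common_cover hA hN (s := ρ w - ρ u) (u := u) (v := w)
      (by omega) (by omega) hba.symm ha (hzw a ha haz) hb (hzw b hb (hbe.le.trans hez))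
    rwa [h.common_cover_unique hA hN hs hr hba.symm ha hb hae hbe haf hbf (hez.trans hzv)
      (hfw.trans hwv)]

theorem linked_of_le_of_lt (hr : ρ v = ρ u + (N + 1)) (ha : u ⋖ a) (hb : u ⋖ b)
    (hza : a ≤ z) (hzb : b ≤ z) (hzv : z < v) : Linked v a b := by
  by_cases hab : a = b
  · exact Or.inl hab
  have h1 := h.rank_lt hzv
  have h2 := h.rank_le (ha.le.trans hza)
  obtain ⟨e, he, hae, hbe⟩ := h.exists_common_cover hA hN (s := ρ z - ρ u) (u := u) (v := z)
      (by omega) (by omega) hab ha hza hb hzb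
  exact Or.inr ⟨e, he.trans hzv.le, hae, hbe⟩

/-- Two distinct linking elements both cover `b`, so they have a common cover `g` in `[b, v]`. It
has rank three above `u`, hence is proper as `N ≥ 3`, and lies above `a` and `c`. -/
theorem linked_trans (hr : ρ v = ρ u + (N + 1)) (ha : u ⋖ a) (hb : u ⋖ b) (hc : u ⋖ c)
    (hab : Linked v a b) (hbc : Linked v b c) : Linked v a c := by
  rcases hab with rfl | ⟨e, hev, hae, hbe⟩
  · exact hbc
  rcases hbc with rfl | ⟨f, hfv, hbf, hcf⟩
  · exact Or.inr ⟨e, hev, hae, hbe⟩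
  by_cases hef : e = f
  · subst hef
    exact Or.inr ⟨e, hev, hae, hcf⟩
  have hrb := h.rank_covBy hb
  obtain ⟨g, hgv, heg, hfg⟩ := h.exists_common_cover hA hN (s := N) (u := b) (v := v)
    le_rfl (by omega) hef hbe hev hbf hfv
  refine h.linked_of_le_of_lt hA hN hr ha hc (hae.le.trans heg.le) (hcf.le.trans hfg.le) ?_
  refine lt_of_le_of_apply_lt (ρ := ρ) hgv ?_
  rw [h.rank_covBy heg, h.rank_covBy hbe, hrb]
  omega

-- Sending a cover of `a` to its other atom is a bijection from the `N` covers of `a` below `v` to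
-- the class without `a`.
open scoped Classical in
theorem card_linked (hr : ρ v = ρ u + (N + 1)) (ha : u ⋖ a) (hav : a ≤ v) :
    ((covers u v).filter (Linked v a)).card = N + 1 := by
  have h2 : A 2 = 2 := hA 2 (by omega) (by omega)
  have hra := h.rank_covBy ha
  have hcard := h.card_covers hav (r := N) (by omega) (by omega)
  rw [hA _ (by omega) le_rfl] at hcard
  have hmem : a ∈ (covers u v).filter (Linked v a) := by
    simp only [Finset.mem_filter, mem_covers]
    exact ⟨⟨ha, hav⟩, Or.inl rfl⟩
  choose! o ho using fun e => h.exists_other_cover (e := e) h2 ha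
  rw [← Finset.card_erase_add_one hmem, ← hcard]
  congr 1
  symm
  refine Finset.card_bij (fun e _ => o e) ?_ ?_ ?_
  · intro e he
    rw [mem_covers] at he
    have hoe := ho e he.1
    simp only [Finset.mem_erase, Finset.mem_filter, mem_covers]
    exact ⟨hoe.1, ⟨hoe.2.1, hoe.2.2.le.trans he.2⟩, Or.inr ⟨e, he.2, he.1, hoe.2.2⟩⟩
  · intro e he f hf hef
    rw [mem_covers] at he hf
    have hoe := ho e he.1
    have hof := ho f hf.1
    rw [← hef] at hof
    exact h.common_cover_unique hA hN le_rfl hr hoe.1.symm ha hoe.2.1 he.1 hoe.2.2 hf.1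
      hof.2.2 he.2 hf.2
  · intro b hb
    simp only [Finset.mem_erase, Finset.mem_filter, mem_covers] at hb
    obtain ⟨hba, ⟨hb, hbv⟩, hl⟩ := hb
    rcases hl with rfl | ⟨e, hev, hae, hbe⟩
    · exact absurd rfl hba
    refine ⟨e, by rw [mem_covers]; exact ⟨hae, hev⟩, ?_⟩
    have hoe := ho e hae
    exact (h.eq_or_eq_of_covBy h2 hba.symm ha hb hae hbe hoe.2.1 hoe.2.2.le).resolve_left hoe.1

end Boolean

/-! ### Linked atoms when `A i = 2` for `2 ≤ i ≤ N`. -/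

section Butterfly

variable (hA : ∀ i, 2 ≤ i → i ≤ N → A i = 2)
include hA

theorem card_level_eq_two (hs : s ≤ N) (huv : u ≤ v) (hr : ρ v = ρ u + s) {i : ℕ} (hi : 1 ≤ i)
    (his : i < s) : (level ρ u v i).card = 2 := by
  induction i, hi using Nat.le_induction with
  | base => rw [h.level_one, h.card_covers huv hr (by omega), hA s (by omega) hs]
  | succ i hi ih =>
    have hm := h.card_level_mul hr (i := i) (by omega)
    rw [ih (by omega), hA (s - i) (by omega) (by omega), hA (i + 1) (by omega) (by omega)] at hm
    omega

/-- The level of `z` has two elements in `[u, w]` and two in `[u, v]`, so all of it lies below `w`.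
-/
theorem le_of_rank_lt (hs : s ≤ N) (hr : ρ v = ρ u + s) (huz : u ≤ z) (hzv : z ≤ v)
    (huw : u ≤ w) (hwv : w ≤ v) (hzw : ρ z < ρ w) : z ≤ w := by
  have hz := h.rank_le huz
  have hw := h.rank_le hwv
  rcases eq_or_lt_of_le huz with rfl | hlt
  · exact huw
  have hz' := h.rank_lt hlt
  have heq : level ρ u w (ρ z - ρ u) = level ρ u v (ρ z - ρ u) := by
    refine Finset.eq_of_subset_of_card_le ?_ ?_
    · intro x hx
      rw [mem_level] at hx ⊢
      exact ⟨hx.1, hx.2.1.trans hwv, hx.2.2⟩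
    · rw [h.card_level_eq_two hA hs (huz.trans hzv) hr (by omega) (by omega),
        h.card_level_eq_two hA (s := ρ w - ρ u) (by omega) huw (by omega) (by omega) (by omega)]
  have : z ∈ level ρ u w (ρ z - ρ u) := by
    rw [heq, mem_level]
    exact ⟨huz, hzv, by omega⟩
  exact (mem_level.1 this).2.1

theorem card_covers_eq_two (hr : ρ v = ρ u + (N + 1)) (huz : u ≤ z) (hzv : z < v)
    (hz : ρ u + 2 ≤ ρ z) : (covers u z).card = 2 := by
  have := h.rank_lt hzv
  rw [h.card_covers huz (r := ρ z - ρ u) (by omega) (by omega), hA _ (by omega) (by omega)]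

variable (hN : 3 ≤ N)
include hN

/-- The proper elements of rank at least two above a given atom all have the same atoms. -/
theorem covers_eq_covers (hr : ρ v = ρ u + (N + 1)) (ha : u ⋖ a) (haz : a ≤ z) (hzv : z < v)
    (hz : ρ u + 2 ≤ ρ z) (haw : a ≤ w) (hwv : w < v) (hw : ρ u + 2 ≤ ρ w) :
    covers u z = covers u w := by
  have hra := h.rank_covBy ha
  -- A reference element of rank three above `u`, proper as `N ≥ 3`. Every cover of `a` below `v`
  -- lies below it, so all atom sets can be compared with its own.
  obtain ⟨g, hg⟩ := h.level_nonempty (haz.trans hzv.le) (r := N) (i := 2) (by omega) (by omega)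
  rw [mem_level] at hg
  have hgv : g < v := lt_of_le_of_apply_lt (ρ := ρ) hg.2.1 (by omega)
  have key : ∀ z, a ≤ z → z < v → ρ u + 2 ≤ ρ z → covers u z = covers u g := by
    intro z haz hzv hz
    obtain ⟨e, hae, hez⟩ := exists_covBy_le_of_lt (lt_of_le_of_apply_lt (ρ := ρ) haz (by omega))
    have hre := h.rank_covBy hae
    have heg : e ≤ g := h.le_of_rank_lt hA le_rfl (u := a) (v := v) (by omega) hae.le
      (hez.trans hzv.le) hg.1 hgv.le (by omega)
    have hue := ha.le.trans hae.le
    have hce := h.card_covers_eq_two hA hr hue (hez.trans_lt hzv) (by omega)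
    have mono : ∀ y, e ≤ y → y < v → covers u e = covers u y := by
      intro y hey hyv
      refine Finset.eq_of_subset_of_card_le ?_ ?_
      · intro x hx
        rw [mem_covers] at hx ⊢
        exact ⟨hx.1, hx.2.trans hey⟩
      · have := h.rank_le hey
        rw [hce, h.card_covers_eq_two hA hr (hue.trans hey) hyv (by omega)]
    rw [← mono z hez hzv, mono g heg hgv]
  rw [key z haz hzv hz, key w haw hwv hw]

theorem butterfly_linked_of_le_of_lt (hr : ρ v = ρ u + (N + 1)) (ha : u ⋖ a) (hb : u ⋖ b)
    (hza : a ≤ z) (hzb : b ≤ z) (hzv : z < v) : Linked v a b := by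
  by_cases hab : a = b
  · exact Or.inl hab
  have hra := h.rank_covBy ha
  have hrb := h.rank_covBy hb
  have haz : a < z := lt_of_le_of_ne hza fun e => by
    subst e
    exact hab (h.eq_of_rank_le hzb (by omega)).symm
  obtain ⟨e, hae, hez⟩ := exists_covBy_le_of_lt haz
  have hre := h.rank_covBy hae
  have := h.rank_le hez
  have hbe : b ∈ covers u e := by
    rw [h.covers_eq_covers hA hN hr ha hae.le (hez.trans_lt hzv) (by omega) hza hzv (by omega),
      mem_covers]
    exact ⟨hb, hzb⟩
  rw [mem_covers] at hbe
  exact Or.inr ⟨e, hez.trans hzv.le, hae, h.covBy_of_rank hbe.2 (by omega)⟩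

theorem le_of_linked (hr : ρ v = ρ u + (N + 1)) (ha : u ⋖ a) (hb : u ⋖ b)
    (hl : Linked v a b) (haz : a ≤ z) (hzv : z ≤ v) (hz : ρ u + 2 ≤ ρ z) : b ≤ z := by
  rcases hl with rfl | ⟨e, hev, hae, hbe⟩
  · exact haz
  have hra := h.rank_covBy ha
  have hre := h.rank_covBy hae
  rcases eq_or_lt_of_le hzv with rfl | hzv
  · exact hbe.le.trans hev
  have : b ∈ covers u z := by
    rw [← h.covers_eq_covers hA hN hr ha hae.le (lt_of_le_of_apply_lt (ρ := ρ) hev (by omega))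
      (by omega) haz hzv hz, mem_covers]
    exact ⟨hb, hbe.le⟩
  exact (mem_covers.1 this).2

theorem butterfly_linked_trans (hr : ρ v = ρ u + (N + 1)) (ha : u ⋖ a) (hb : u ⋖ b) (hc : u ⋖ c)
    (hab : Linked v a b) (hbc : Linked v b c) : Linked v a c := by
  rcases hbc with rfl | ⟨e, hev, hbe, hce⟩
  · exact hab
  have hrb := h.rank_covBy hb
  have hre := h.rank_covBy hbe
  exact h.butterfly_linked_of_le_of_lt hA hN hr ha hc
    (h.le_of_linked hA hN hr hb ha hab.symm hbe.le hev (by omega)) hce.le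
    (lt_of_le_of_apply_lt (ρ := ρ) hev (by omega))

-- The class consists of the two atoms below any cover `e` of `a` with `e ≤ v`.
open scoped Classical in
theorem butterfly_card_linked (hr : ρ v = ρ u + (N + 1)) (ha : u ⋖ a) (hav : a ≤ v) :
    ((covers u v).filter (Linked v a)).card = 2 := by
  have hra := h.rank_covBy ha
  obtain ⟨e, hae, hev⟩ := exists_covBy_le_of_lt (lt_of_le_of_apply_lt (ρ := ρ) hav (by omega))
  have hre := h.rank_covBy hae
  have hev' : e < v := lt_of_le_of_apply_lt (ρ := ρ) hev (by omega)
  rw [← h.card_covers_eq_two hA hr (ha.le.trans hae.le) hev' (by omega)]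
  congr 1
  ext b
  simp only [Finset.mem_filter, mem_covers]
  constructor
  · rintro ⟨⟨hb, hbv⟩, hl⟩
    exact ⟨hb, h.le_of_linked hA hN hr ha hb hl hae.le hev (by omega)⟩
  · rintro ⟨hb, hbe⟩
    exact ⟨⟨hb, hbe.trans hev⟩, h.butterfly_linked_of_le_of_lt hA hN hr ha hb hae.le hbe hev'⟩

end Butterfly

end IsCoverRegular

end FinPoset

/-! ### Divisibility, and the recursion for `A` from the Euler relation. -/

namespace FinPoset

theorem dvd_card_of_card_class {α : Type*} (s : Finset α) (R : α → α → Prop) [DecidableRel R]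
    (hrefl : ∀ a ∈ s, R a a) (hsymm : ∀ a ∈ s, ∀ b ∈ s, R a b → R b a)
    (htrans : ∀ a ∈ s, ∀ b ∈ s, ∀ c ∈ s, R a b → R b c → R a c) {k : ℕ}
    (hk : ∀ a ∈ s, (s.filter (R a)).card = k) : k ∣ s.card := by
  classical
  rw [Finset.card_eq_sum_card_image (fun a => s.filter (R a)) s]
  refine Finset.dvd_sum fun t ht => ?_
  obtain ⟨a, ha, rfl⟩ := Finset.mem_image.1 ht
  refine dvd_of_eq ?_
  rw [← hk a ha]
  congr 1
  ext b
  simp only [Finset.mem_filter]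
  refine and_congr_right fun hb => ⟨fun hab => ?_, fun hba => ?_⟩
  · ext c
    simp only [Finset.mem_filter]
    exact and_congr_right fun hc =>
      ⟨fun hbc => htrans a ha b hb c hc hab hbc,
        fun hac => htrans b hb a ha c hc (hsymm a ha b hb hab) hac⟩
  · have : b ∈ s.filter (R b) := Finset.mem_filter.2 ⟨hb, hrefl b hb⟩
    rw [hba] at this
    exact (Finset.mem_filter.1 this).2

/-- Separates the two lowest and two highest levels. Among the levels in between, the recursion uses
only values of `A` up to `t + 2`. -/
theorem sum_range_alternating_split (t : ℕ) (ht : Even t) (f : ℕ → ℤ) :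
    ∑ i ∈ Finset.range (t + 4 + 1), (-1 : ℤ) ^ i * f i =
      f 0 - f 1 + ∑ i ∈ Finset.range (t + 1), (-1 : ℤ) ^ i * f (i + 2) - f (t + 3) + f (t + 4) := by
  rw [Finset.sum_range_succ, Finset.sum_range_succ, Finset.sum_range_succ', Finset.sum_range_succ']
  have h3 : (-1 : ℤ) ^ (t + 3) = -1 := by rw [pow_add, ht.neg_one_pow]; norm_num
  have h4 : (-1 : ℤ) ^ (t + 4) = 1 := by rw [pow_add, ht.neg_one_pow]; norm_num
  have hs : ∑ i ∈ Finset.range (t + 1), (-1 : ℤ) ^ (i + 1 + 1) * f (i + 1 + 1) =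
      ∑ i ∈ Finset.range (t + 1), (-1 : ℤ) ^ i * f (i + 2) :=
    Finset.sum_congr rfl fun i _ => by rw [pow_succ, pow_succ]; ring_nf
  rw [hs, h3, h4]
  ring

theorem sum_range_alternating_one (t : ℕ) (ht : Even t) :
    ∑ i ∈ Finset.range (t + 1), (-1 : ℤ) ^ i = 1 := by
  obtain ⟨k, rfl⟩ := ht
  induction k with
  | zero => simp
  | succ k ih =>
    rw [show k + 1 + (k + 1) + 1 = k + k + 1 + 1 + 1 by ring, Finset.sum_range_succ,
      Finset.sum_range_succ, ih]
    simp [pow_succ]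

theorem sum_range_alternating_choose (t : ℕ) (ht : Even t) :
    ∑ i ∈ Finset.range (t + 1), (-1 : ℤ) ^ i * ((t + 4).choose (i + 2) : ℤ) = 2 * t + 6 := by
  have h1 := Int.alternating_sum_range_choose_of_ne (n := t + 4) (by omega)
  rw [sum_range_alternating_split t ht fun i => ((t + 4).choose i : ℤ)] at h1
  have h2 : (t + 4).choose (t + 3) = t + 4 := Nat.choose_succ_self_right (t + 3)
  simp only [h2, Nat.choose_zero_right, Nat.choose_one_right, Nat.choose_self] at h1
  push_cast at h1
  linarith

namespace IsCoverRegular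

variable {P : Type*} [PartialOrder P] [Fintype P]
variable {ρ : P → ℕ} {A : ℕ → ℕ} (h : IsCoverRegular ρ A) {u v : P} {N t : ℕ}
include h

theorem dvd_A_succ (hA : ∀ i, 1 ≤ i → i ≤ N → A i = i) (hN : 3 ≤ N) (huv : u ≤ v)
    (hr : ρ v = ρ u + (N + 1)) : N + 1 ∣ A (N + 1) := by
  classical
  rw [← h.card_covers huv hr (by omega)]
  refine dvd_card_of_card_class _ (Linked v) (fun a _ => Or.inl rfl) (fun a _ b _ hab => hab.symm)
    (fun a ha b hb c hc => ?_) fun a ha => ?_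
  · exact h.linked_trans hA hN hr (mem_covers.1 ha).1 (mem_covers.1 hb).1 (mem_covers.1 hc).1
  · rw [← h.card_linked hA hN hr (mem_covers.1 ha).1 (mem_covers.1 ha).2]

theorem two_dvd_A_succ (hA : ∀ i, 2 ≤ i → i ≤ N → A i = 2) (hN : 3 ≤ N) (huv : u ≤ v)
    (hr : ρ v = ρ u + (N + 1)) : 2 ∣ A (N + 1) := by
  classical
  rw [← h.card_covers huv hr (by omega)]
  refine dvd_card_of_card_class _ (Linked v) (fun a _ => Or.inl rfl) (fun a _ b _ hab => hab.symm)
    (fun a ha b hb c hc => ?_) fun a ha => ?_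
  · exact h.butterfly_linked_trans hA hN hr (mem_covers.1 ha).1 (mem_covers.1 hb).1
      (mem_covers.1 hc).1
  · rw [← h.butterfly_card_linked hA hN hr (mem_covers.1 ha).1 (mem_covers.1 ha).2]

/-- The Euler relation of an interval of even rank whose middle levels have sizes proportional to
a given sequence. -/
theorem euler_of_proportional (huv : u ≤ v) (hr : ρ v = ρ u + (t + 4)) (ht : Even t) (D : ℕ)
    (c : ℕ → ℕ) (hc : ∀ i ≤ t, D * (level ρ u v (i + 2)).card = A (t + 4) * A (t + 3) * c i) :
    (D : ℤ) * (2 - 2 * A (t + 4)) +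
      A (t + 4) * A (t + 3) * ∑ i ∈ Finset.range (t + 1), (-1 : ℤ) ^ i * c i = 0 := by
  have he := h.euler huv hr (by omega)
  rw [sum_range_alternating_split t ht fun i => ((level ρ u v i).card : ℤ)] at he
  simp only [h.level_zero huv, h.level_self huv hr, h.level_one, h.level_pred (r := t + 3) hr,
    h.card_covers huv hr (by omega), h.card_cocovers huv hr (by omega),
    Finset.card_singleton] at he
  have hs : (D : ℤ) * ∑ i ∈ Finset.range (t + 1), (-1 : ℤ) ^ i * (level ρ u v (i + 2)).card =
      A (t + 4) * A (t + 3) * ∑ i ∈ Finset.range (t + 1), (-1 : ℤ) ^ i * c i := by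
    rw [Finset.mul_sum, Finset.mul_sum]
    refine Finset.sum_congr rfl fun i hi => ?_
    have := hc i (by rw [Finset.mem_range] at hi; omega)
    zify at this
    linear_combination (-1 : ℤ) ^ i * this
  rw [← hs]
  push_cast at he
  linear_combination (D : ℤ) * he

/-- The Euler relation reads `A (t + 4) * (t + 4 - A (t + 3)) = t + 4`, which forces `A (t + 3) < t
+ 4`. Being a positive multiple of `t + 3`, it equals `t + 3`. -/
theorem A_boolean_step (hA : ∀ i, 1 ≤ i → i ≤ t + 2 → A i = i) (ht : Even t) (ht2 : 2 ≤ t)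
    (huv : u ≤ v) (hr : ρ v = ρ u + (t + 4)) : A (t + 3) = t + 3 ∧ A (t + 4) = t + 4 := by
  obtain ⟨w, hw⟩ := h.level_nonempty huv hr (i := t + 3) (by omega)
  rw [mem_level] at hw
  have hdvd : t + 3 ∣ A (t + 3) := h.dvd_A_succ hA (by omega) hw.1 hw.2.2
  have hpos := h.A_pos hw.1 hw.2.2 (by omega)
  have hpos' := h.A_pos huv hr (by omega)
  -- From level two on, level sizes and binomial coefficients obey the same recursion, so they are
  -- proportional.
  have hc : ∀ i ≤ t, ((t + 4) * (t + 3)) * (level ρ u v (i + 2)).card =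
      A (t + 4) * A (t + 3) * (t + 4).choose (i + 2) := by
    intro i hi
    induction i with
    | zero =>
      have hm := h.card_level_mul hr (i := 1) (by omega)
      rw [h.level_one, h.card_covers huv hr (by omega), show t + 4 - 1 = t + 3 by omega,
        hA (1 + 1) (by omega) (by omega)] at hm
      have hch := Nat.choose_succ_right_eq (t + 4) 1
      rw [Nat.choose_one_right, show t + 4 - 1 = t + 3 by omega] at hch
      rw [hm, ← hch]
      norm_num
      ring
    | succ i ih =>
      have hm := h.card_level_mul hr (i := i + 2) (by omega)
      rw [hA (t + 4 - (i + 2)) (by omega) (by omega), hA (i + 2 + 1) (by omega) (by omega)] at hm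
      have hch := Nat.choose_succ_right_eq (t + 4) (i + 2)
      have ih := ih (by omega)
      refine Nat.eq_of_mul_eq_mul_right (show 0 < i + 2 + 1 by omega) ?_
      rw [show i + 1 + 2 = i + 2 + 1 by ring]
      calc (t + 4) * (t + 3) * (level ρ u v (i + 2 + 1)).card * (i + 2 + 1)
          = (t + 4) * (t + 3) * (level ρ u v (i + 2)).card * (t + 4 - (i + 2)) := by
            rw [mul_assoc, ← hm, ← mul_assoc]
        _ = A (t + 4) * A (t + 3) * ((t + 4).choose (i + 2 + 1) * (i + 2 + 1)) := by
            rw [ih, hch, mul_assoc]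
        _ = _ := by ring
  have he := h.euler_of_proportional huv hr ht _ _ hc
  rw [sum_range_alternating_choose t ht] at he
  push_cast at he
  have key : (A (t + 4) : ℤ) * (t + 4 - A (t + 3)) = t + 4 := by
    have : (2 * (t : ℤ) + 6) * ((A (t + 4) : ℤ) * (t + 4 - A (t + 3))) = (2 * t + 6) * (t + 4) := by
      linear_combination -he
    exact mul_left_cancel₀ (by positivity) this
  have hlt : A (t + 3) < t + 4 := by
    by_contra hcon
    have : (A (t + 4) : ℤ) * (t + 4 - A (t + 3)) ≤ 0 :=
      mul_nonpos_of_nonneg_of_nonpos (by positivity) (by omega)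
    omega
  have heq : A (t + 3) = t + 3 := le_antisymm (by omega) (Nat.le_of_dvd hpos hdvd)
  rw [heq] at key
  push_cast at key
  exact ⟨heq, by linarith⟩

/-- The middle levels all have the same size, and the Euler relation becomes `A (t + 4) * (4 - A (t
+ 3)) = 4`. A positive even number below 4 is 2. -/
theorem A_butterfly_step (hA : ∀ i, 2 ≤ i → i ≤ t + 2 → A i = 2) (ht : Even t) (ht2 : 2 ≤ t)
    (huv : u ≤ v) (hr : ρ v = ρ u + (t + 4)) : A (t + 3) = 2 ∧ A (t + 4) = 2 := by
  obtain ⟨w, hw⟩ := h.level_nonempty huv hr (i := t + 3) (by omega)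
  rw [mem_level] at hw
  have hdvd : 2 ∣ A (t + 3) := h.two_dvd_A_succ hA (by omega) hw.1 hw.2.2
  have hpos := h.A_pos hw.1 hw.2.2 (by omega)
  have hpos' := h.A_pos huv hr (by omega)
  have hc : ∀ i ≤ t, 2 * (level ρ u v (i + 2)).card = A (t + 4) * A (t + 3) * 1 := by
    intro i hi
    induction i with
    | zero =>
      have hm := h.card_level_mul hr (i := 1) (by omega)
      rw [h.level_one, h.card_covers huv hr (by omega), show t + 4 - 1 = t + 3 by omega,
        hA (1 + 1) (by omega) (by omega)] at hm
      rw [hm]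
      ring
    | succ i ih =>
      have hm := h.card_level_mul hr (i := i + 2) (by omega)
      rw [hA (t + 4 - (i + 2)) (by omega) (by omega), hA (i + 2 + 1) (by omega) (by omega)] at hm
      have ih := ih (by omega)
      rw [show i + 1 + 2 = i + 2 + 1 by ring]
      omega
  have he := h.euler_of_proportional huv hr ht _ (fun _ => 1) hc
  simp only [Nat.cast_one, mul_one] at he
  rw [sum_range_alternating_one t ht] at he
  push_cast at he
  have key : (A (t + 4) : ℤ) * (4 - A (t + 3)) = 4 := by linear_combination -he
  have hlt : A (t + 3) < 4 := by
    by_contra hcon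
    have : (A (t + 4) : ℤ) * (4 - A (t + 3)) ≤ 0 :=
      mul_nonpos_of_nonneg_of_nonpos (by positivity) (by omega)
    omega
  have heq : A (t + 3) = 2 := by omega
  rw [heq] at key
  push_cast at key
  exact ⟨heq, by linarith⟩

theorem A_boolean_or_butterfly {m : ℕ} (hm : 2 ≤ m) (huv : u ≤ v)
    (hr : ρ v = ρ u + (2 * m + 1)) :
    (∀ i, 1 ≤ i → i ≤ 2 * m → A i = i) ∨ (∀ i, 2 ≤ i → i ≤ 2 * m → A i = 2) := by
  have h1 := h.A_one huv hr (by omega)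
  have h2 := h.A_two huv hr (by omega)
  have hlev : ∀ t, t + 4 ≤ 2 * m + 1 → ∃ w, u ≤ w ∧ ρ w = ρ u + (t + 4) := fun t ht => by
    obtain ⟨w, hw⟩ := h.level_nonempty huv hr ht
    exact ⟨w, (mem_level.1 hw).1, (mem_level.1 hw).2.2⟩
  rcases h.A_three_four huv hr (by omega) with ⟨h3, h4⟩ | ⟨h3, h4⟩
  · right
    have key : ∀ j, 2 ≤ j → j ≤ m → ∀ i, 2 ≤ i → i ≤ 2 * j → A i = 2 := by
      intro j hj
      induction j, hj using Nat.le_induction with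
      | base =>
        intro _ i hi hi'
        obtain rfl | rfl | rfl : i = 2 ∨ i = 3 ∨ i = 4 := by omega
        exacts [h2, h3, h4]
      | succ j hj ih =>
        intro hjm i hi hi'
        have ih := ih (by omega)
        obtain ⟨w, huw, hw⟩ := hlev (2 * j - 2) (by omega)
        -- `t + 2 = 2 * j` is the last known rank; the step supplies ranks `2 * j + 1` and `2 * j +
        -- 2`.
        have hs := h.A_butterfly_step (t := 2 * j - 2)
          (fun i hi hi' => ih i hi (by omega)) ⟨j - 1, by omega⟩ (by omega) huw hw
        obtain hi' | rfl | rfl : i ≤ 2 * j ∨ i = 2 * j - 2 + 3 ∨ i = 2 * j - 2 + 4 := by omega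
        exacts [ih i hi hi', hs.1, hs.2]
    exact key m hm le_rfl
  · left
    have key : ∀ j, 2 ≤ j → j ≤ m → ∀ i, 1 ≤ i → i ≤ 2 * j → A i = i := by
      intro j hj
      induction j, hj using Nat.le_induction with
      | base =>
        intro _ i hi hi'
        obtain rfl | rfl | rfl | rfl : i = 1 ∨ i = 2 ∨ i = 3 ∨ i = 4 := by omega
        exacts [h1, h2, h3, h4]
      | succ j hj ih =>
        intro hjm i hi hi'
        have ih := ih (by omega)
        obtain ⟨w, huw, hw⟩ := hlev (2 * j - 2) (by omega)
        have hs := h.A_boolean_step (t := 2 * j - 2)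
          (fun i hi hi' => ih i hi (by omega)) ⟨j - 1, by omega⟩ (by omega) huw hw
        obtain hi' | rfl | rfl : i ≤ 2 * j ∨ i = 2 * j - 2 + 3 ∨ i = 2 * j - 2 + 4 := by omega
        exacts [ih i hi hi', hs.1, hs.2]
    exact key m hm le_rfl

end IsCoverRegular

end FinPoset

/-! ### Recognizing summations, and link classes of atoms. -/

namespace FinPoset

/-- A family of maps `Q → P` that is jointly surjective and respects and reflects the order of a
summation of copies of `Q` identifies `P` with this summation. -/
theorem exists_orderIso_kSum {P Q ι : Type*} [PartialOrder P] [PartialOrder Q] [BoundedOrder Q]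
    [Finite ι] [Nonempty ι] (φ : ι → Q → P)
    (hle : ∀ i j p q, φ i p ≤ φ j q ↔ p = ⊥ ∨ q = ⊤ ∨ (i = j ∧ p ≤ q))
    (hsurj : ∀ x, ∃ i q, φ i q = x) : ∃ k : ℕ, 0 < k ∧ Nonempty (P ≃o KSum k Q) := by
  refine ⟨Nat.card ι, Nat.card_pos, ?_⟩
  let e : Fin (Nat.card ι) ≃ ι := (Finite.equivFin ι).symm
  let f : Copies (Nat.card ι) Q → P := fun c => φ (e c.copy) c.elt
  have hf : ∀ a b, f a ≤ f b ↔ a ≤ b := fun a b => by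
    refine (hle _ _ _ _).trans ?_
    rw [e.injective.eq_iff]
    rfl
  let g : KSum (Nat.card ι) Q ↪o P := OrderEmbedding.ofMapLEIff
    (fun c => f (ofAntisymmetrization (· ≤ ·) c)) fun a b =>
      (hf _ _).trans ofAntisymmetrization_le_ofAntisymmetrization_iff
  have hg : Function.Surjective g := by
    intro x
    obtain ⟨i, q, rfl⟩ := hsurj x
    let c : Copies (Nat.card ι) Q := ⟨e.symm i, q⟩
    -- The representative chosen for the class of `c` need not be `c`, but the two are equivalent,
    -- and `f` identifies equivalent elements.
    have hc : AntisymmRel (· ≤ ·)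
        (ofAntisymmetrization (· ≤ ·) (toAntisymmetrization (· ≤ ·) c)) c :=
      Quotient.exact (toAntisymmetrization_ofAntisymmetrization _ _)
    refine ⟨toAntisymmetrization (· ≤ ·) c, ?_⟩
    have hfc : f c = φ i q := by simp [f, c]
    rw [← hfc]
    exact le_antisymm ((hf _ _).2 hc.1) ((hf _ _).2 hc.2)
  exact ⟨(RelIso.ofSurjective g hg).symm⟩

section LinkClass

variable {P : Type*} [PartialOrder P] [Fintype P]

open scoped Classical in
/-- The atoms of `[u, v]` that are linked to `a`. -/
noncomputable def linkClass (u v a : P) : Finset P := (covers u v).filter (Linked v a)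

theorem mem_linkClass {u v a b : P} :
    b ∈ linkClass u v a ↔ (u ⋖ b ∧ b ≤ v) ∧ Linked v a b := by
  simp [linkClass]

theorem self_mem_linkClass {u v a : P} (ha : u ⋖ a) (hav : a ≤ v) : a ∈ linkClass u v a :=
  mem_linkClass.2 ⟨⟨ha, hav⟩, Or.inl rfl⟩

/-- The type of link classes of atoms of `[u, v]`. -/
abbrev LinkClass (u v : P) : Type _ := {C : Finset P // ∃ a ∈ covers u v, C = linkClass u v a}

theorem LinkClass.mem_covers {u v b : P} (C : LinkClass u v) (hb : b ∈ C.1) : u ⋖ b ∧ b ≤ v := by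
  obtain ⟨C, a, ha, rfl⟩ := C
  exact (mem_linkClass.1 hb).1

/-- Being linked is transitive on the atoms of `[u, v]`. -/
def LinkTrans (u v : P) : Prop :=
  ∀ a b c : P, u ⋖ a → u ⋖ b → u ⋖ c → Linked v a b → Linked v b c → Linked v a c

theorem LinkClass.mem_iff {u v b c : P} (ht : LinkTrans u v) (C : LinkClass u v) (hb : b ∈ C.1) :
    c ∈ C.1 ↔ (u ⋖ c ∧ c ≤ v) ∧ Linked v b c := by
  obtain ⟨C, a, ha, rfl⟩ := C
  rw [FinPoset.mem_covers] at ha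
  obtain ⟨⟨hub, -⟩, hab⟩ := mem_linkClass.1 hb
  rw [mem_linkClass]
  exact and_congr_right fun hc => ⟨fun hac => ht b a c hub ha.1 hc.1 hab.symm hac,
    fun hbc => ht a b c ha.1 hub hc.1 hab hbc⟩

theorem LinkClass.eq_of_linked {u v b c : P} (ht : LinkTrans u v) (C D : LinkClass u v)
    (hb : b ∈ C.1) (hc : c ∈ D.1) (hbc : Linked v b c) : C = D := by
  refine Subtype.ext (Finset.ext fun x => ?_)
  have hub := (C.mem_covers hb).1
  have huc := (D.mem_covers hc).1
  rw [C.mem_iff ht hb, D.mem_iff ht hc]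
  exact and_congr_right fun hx => ⟨fun hbx => ht c b x huc hub hx.1 hbc.symm hbx,
    fun hcx => ht b c x hub huc hx.1 hbc hcx⟩

end LinkClass

namespace IsCoverRegular

section Boolean

variable {P : Type*} [PartialOrder P] [Fintype P]
variable {ρ : P → ℕ} {A : ℕ → ℕ} (h : IsCoverRegular ρ A) {u v z w : P} {N : ℕ}
  (hA : ∀ i, 1 ≤ i → i ≤ N → A i = i) (hN : 3 ≤ N) (hr : ρ v = ρ u + (N + 1))
include h hA hN hr

theorem card_linkClass (C : LinkClass u v) : C.1.card = N + 1 := by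
  obtain ⟨C, a, ha, rfl⟩ := C
  rw [mem_covers] at ha
  exact h.card_linked hA hN hr ha.1 ha.2

omit hN in
theorem card_covers_of_lt (huz : u ≤ z) (hzv : z < v) : ρ z = ρ u + (covers u z).card := by
  have h1 := h.rank_lt hzv
  rcases eq_or_lt_of_le huz with rfl | hlt
  · have : covers u u = ∅ := by
      ext a
      simp only [mem_covers, Finset.notMem_empty, iff_false]
      exact fun ha => ha.1.lt.not_ge ha.2
    simp [this]
  · have h2 := h.rank_lt hlt
    rw [h.card_covers huz (r := ρ z - ρ u) (by omega) (by omega), hA _ (by omega) (by omega)]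
    omega

theorem eq_of_covers_eq (huz : u ≤ z) (hzv : z ≤ v) (huw : u ≤ w) (hwv : w ≤ v)
    (hzw : covers u z = covers u w) : z = w := by
  have key : ∀ a, u ⋖ a → (a ≤ z ↔ a ≤ w) := fun a ha => by
    have : a ∈ covers u z ↔ a ∈ covers u w := by rw [hzw]
    simpa [ha] using this
  exact le_antisymm
    (h.le_of_covers_le hA hN le_rfl hr huz hzv huw hwv fun a ha => (key a ha).1)
    (h.le_of_covers_le hA hN le_rfl hr huw hwv huz hzv fun a ha => (key a ha).2)

theorem exists_covers_eq_insert [DecidableEq P] (C : LinkClass u v) {T : Finset P} {b : P}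
    (huz : u < z) (hzv : z < v) (hz : covers u z = T) (hTC : T ⊆ C.1) (hb : b ∈ C.1) (hbT : b ∉ T)
    (hcard : T.card + 1 < N + 1) :
    ∃ w, u ≤ w ∧ w < v ∧ covers u w = insert b T := by
  have ht : LinkTrans u v := fun a b c ha hb hc => h.linked_trans hA hN hr ha hb hc
  have hrz := h.card_covers_of_lt hA hr huz.le hzv
  rw [hz] at hrz
  have huz' := h.rank_lt huz
  have hcov := h.card_covers hzv.le (r := N + 1 - T.card) (by omega) (by omega)
  rw [hA _ (by omega) (by omega)] at hcov
  obtain ⟨a, ha, haz⟩ := exists_covBy_le_of_lt huz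
  have haT : a ∈ T := by rw [← hz, mem_covers]; exact ⟨ha, haz⟩
  -- Each cover of `z` adds one atom of the class to `T`. Different covers add different atoms, and
  -- there are as many covers as atoms in `C.1 \ T`, so `b` is added by some cover.
  have hw : ∀ w ∈ covers z v, ∃ x ∈ C.1 \ T, covers u w = insert x T := by
    intro w hw
    rw [mem_covers] at hw
    have hrw := h.rank_covBy hw.1
    have hwv : w < v := lt_of_le_of_apply_lt (ρ := ρ) hw.2 (by omega)
    have huw := huz.le.trans hw.1.le
    have hrw' := h.card_covers_of_lt hA hr huw hwv
    have hsub : T ⊆ covers u w := by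
      intro y hy
      rw [← hz, mem_covers] at hy
      rw [mem_covers]
      exact ⟨hy.1, hy.2.trans hw.1.le⟩
    obtain ⟨x, hx, hxT⟩ := Finset.exists_mem_notMem_of_card_lt_card
      (s := T) (t := covers u w) (by omega)
    refine ⟨x, ?_, ?_⟩
    · rw [mem_covers] at hx
      rw [Finset.mem_sdiff, C.mem_iff ht (hTC haT)]
      exact ⟨⟨⟨hx.1, hx.2.trans hw.2⟩, h.linked_of_le_of_lt hA hN hr ha hx.1
        (haz.trans hw.1.le) hx.2 hwv⟩, hxT⟩
    · symm
      refine Finset.eq_of_subset_of_card_le ?_ ?_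
      · rw [Finset.insert_subset_iff]
        exact ⟨hx, hsub⟩
      · rw [Finset.card_insert_of_notMem hxT]
        omega
  choose! x hx hxw using hw
  have himg : (covers z v).image x = C.1 \ T := by
    refine Finset.eq_of_subset_of_card_le ?_ ?_
    · intro y hy
      obtain ⟨w, hw, rfl⟩ := Finset.mem_image.1 hy
      exact hx w hw
    · rw [Finset.card_image_of_injOn, hcov, Finset.card_sdiff_of_subset hTC,
        h.card_linkClass hA hN hr]
      intro w hw w' hw' hww'
      rw [Finset.mem_coe] at hw hw'
      have h1 := hxw w hw
      have h2 := hxw w' hw'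
      rw [hww', ← h2] at h1
      rw [mem_covers] at hw hw'
      exact h.eq_of_covers_eq hA hN hr (huz.le.trans hw.1.le) hw.2 (huz.le.trans hw'.1.le) hw'.2 h1
  have hb' : b ∈ (covers z v).image x := by
    rw [himg, Finset.mem_sdiff]
    exact ⟨hb, hbT⟩
  obtain ⟨w, hw, rfl⟩ := Finset.mem_image.1 hb'
  have hcw := hxw w hw
  rw [mem_covers] at hw
  have hrw := h.rank_covBy hw.1
  exact ⟨w, huz.le.trans hw.1.le, lt_of_le_of_apply_lt (ρ := ρ) hw.2 (by omega), hcw⟩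

/-- Every proper subset of a link class is the set of atoms of a proper element. -/
theorem exists_covers_eq (C : LinkClass u v) (T : Finset P) (hTC : T ⊆ C.1)
    (hcard : T.card < N + 1) : ∃ z, u ≤ z ∧ z < v ∧ covers u z = T := by
  classical
  have huv : u < v := by
    obtain ⟨C, a, ha, rfl⟩ := C
    rw [mem_covers] at ha
    exact ha.1.lt.trans_le ha.2
  have hempty : covers u u = ∅ := by
    ext a
    simp only [mem_covers, Finset.notMem_empty, iff_false]
    exact fun ha => ha.1.lt.not_ge ha.2
  induction T using Finset.induction_on with
  | empty => exact ⟨u, le_rfl, huv, hempty⟩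
  | insert b T hbT ih =>
    rw [Finset.insert_subset_iff] at hTC
    rw [Finset.card_insert_of_notMem hbT] at hcard
    obtain ⟨z, huz, hzv, hz⟩ := ih hTC.2 (by omega)
    rcases eq_or_lt_of_le huz with rfl | hlt
    · have hb := C.mem_covers hTC.1
      have hrb := h.rank_covBy hb.1
      refine ⟨b, hb.1.le, lt_of_le_of_apply_lt (ρ := ρ) hb.2 (by omega), ?_⟩
      rw [← hz, hempty, ← h.level_one, h.level_self hb.1.le hrb]
      rfl
    · exact h.exists_covers_eq_insert hA hN hr C hlt hzv hz hTC.2 hTC.1 hbT hcard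

end Boolean

/-! ### The Boolean case: gluing the link classes. -/

section Summation

variable {P : Type*} [PartialOrder P] [BoundedOrder P] [Fintype P]
variable {ρ : P → ℕ} {A : ℕ → ℕ} (h : IsCoverRegular ρ A) {N : ℕ} (hN : 3 ≤ N)
  (hr : ρ (⊤ : P) = ρ (⊥ : P) + (N + 1))
include h hN hr

omit hN in
theorem nonempty_linkClass : Nonempty (LinkClass (⊥ : P) ⊤) := by
  obtain ⟨a, ha⟩ := h.level_nonempty bot_le hr (i := 1) (by omega)
  rw [h.level_one] at ha
  exact ⟨⟨_, a, ha, rfl⟩⟩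

theorem exists_orderIso_kSum_boolean (hA : ∀ i, 1 ≤ i → i ≤ N → A i = i) :
    ∃ k : ℕ, 0 < k ∧ Nonempty (P ≃o KSum k (BooleanLattice (N + 1))) := by
  classical
  have ht : LinkTrans (⊥ : P) ⊤ := fun a b c ha hb hc => h.linked_trans hA hN hr ha hb hc
  have hne := h.nonempty_linkClass hr
  have hCcard (C : LinkClass (⊥ : P) ⊤) := h.card_linkClass hA hN hr C
  let e (C : LinkClass (⊥ : P) ⊤) : C.1 ≃ Fin (N + 1) := C.1.equivFinOfCardEq (hCcard C)
  let β (C : LinkClass (⊥ : P) ⊤) : Fin (N + 1) ↪ P :=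
    (e C).symm.toEmbedding.trans (Function.Embedding.subtype _)
  have hβ (C) (i) : β C i ∈ C.1 := ((e C).symm i).2
  -- A proper subset of a class goes to the element with exactly these atoms. The full set is
  -- treated apart, since `⊤` also lies above the atoms of all other classes.
  have hex : ∀ (C : LinkClass (⊥ : P) ⊤) (T : BooleanLattice (N + 1)), ∃ z : P,
      (T = ⊤ → z = ⊤) ∧ (T ≠ ⊤ → z < ⊤ ∧ covers ⊥ z = T.map (β C)) := by
    intro C T
    by_cases hT : T = ⊤
    · exact ⟨⊤, fun _ => rfl, fun hT' => absurd hT hT'⟩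
    · have hTcard : T.card < N + 1 := by
        have := Finset.card_lt_univ_of_notMem (s := T)
          (Classical.not_forall.1 fun hall => hT (Finset.eq_univ_iff_forall.2 hall)).choose_spec
        simpa using this
      obtain ⟨z, -, hzv, hz⟩ := h.exists_covers_eq hA hN hr C (T.map (β C))
        (fun y hy => by
          obtain ⟨i, -, rfl⟩ := Finset.mem_map.1 hy
          exact hβ C i) (by rwa [Finset.card_map])
      exact ⟨z, fun hT' => absurd hT' hT, fun _ => ⟨hzv, hz⟩⟩
  choose φ hφtop hφ using hex
  have hφlt (C T) (hT : T ≠ ⊤) : φ C T < ⊤ := (hφ C T hT).1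
  have hφcov (C T) (hT : T ≠ ⊤) : covers ⊥ (φ C T) = T.map (β C) := (hφ C T hT).2
  have hempty : covers (⊥ : P) ⊥ = ∅ := by
    ext a
    simp only [mem_covers, Finset.notMem_empty, iff_false]
    exact fun ha => ha.1.lt.not_ge ha.2
  have hbt : (⊥ : BooleanLattice (N + 1)) ≠ ⊤ := bot_ne_top
  have hφbot (C) : φ C ⊥ = ⊥ := by
    refine h.eq_of_covers_eq hA hN hr bot_le le_top le_rfl bot_le ?_
    rw [hφcov C ⊥ hbt, hempty]
    rfl
  refine exists_orderIso_kSum φ (fun C D S T => ⟨fun hle => ?_, ?_⟩) fun x => ?_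
  · by_cases hS : S = ⊥
    · exact Or.inl hS
    by_cases hT : T = ⊤
    · exact Or.inr (Or.inl hT)
    refine Or.inr (Or.inr ?_)
    have hS' : S ≠ ⊤ := fun hS' => by
      rw [hφtop C S hS', top_le_iff] at hle
      exact (hφlt D T hT).ne hle
    have hsub : S.map (β C) ⊆ T.map (β D) := by
      rw [← hφcov C S hS', ← hφcov D T hT]
      intro a ha
      rw [mem_covers] at ha ⊢
      exact ⟨ha.1, ha.2.trans hle⟩
    obtain ⟨i, hi⟩ := Finset.nonempty_iff_ne_empty.2 hS
    have hmem := hsub (Finset.mem_map_of_mem _ hi)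
    obtain ⟨j, -, hj⟩ := Finset.mem_map.1 hmem
    -- A shared atom forces the two classes to coincide.
    have hCD : C = D := C.eq_of_linked ht D (hβ C i) (hβ D j) (Or.inl hj.symm)
    subst hCD
    exact ⟨rfl, Finset.map_subset_map.1 hsub⟩
  · rintro (rfl | rfl | ⟨rfl, hST⟩)
    · rw [hφbot]
      exact bot_le
    · rw [hφtop D ⊤ rfl]
      exact le_top
    · by_cases hT : T = ⊤
      · rw [hφtop C T hT]
        exact le_top
      have hS : S ≠ ⊤ := fun hS => hT (top_le_iff.1 (hS ▸ hST))
      refine h.le_of_covers_le hA hN le_rfl hr bot_le le_top bot_le le_top fun a ha haS => ?_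
      have : a ∈ covers ⊥ (φ C T) := by
        rw [hφcov C T hT]
        refine Finset.map_subset_map.2 hST ?_
        rw [← hφcov C S hS, mem_covers]
        exact ⟨ha, haS⟩
      exact (mem_covers.1 this).2
  · rcases eq_or_lt_of_le (le_top : x ≤ ⊤) with rfl | hxtop
    · exact ⟨hne.some, ⊤, hφtop _ _ rfl⟩
    rcases eq_or_lt_of_le (bot_le : ⊥ ≤ x) with rfl | hxbot
    · exact ⟨hne.some, ⊥, hφbot _⟩
    obtain ⟨a, ha, hax⟩ := exists_covBy_le_of_lt hxbot
    let C : LinkClass (⊥ : P) ⊤ := ⟨linkClass ⊥ ⊤ a, a, by simp [ha], rfl⟩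
    have haC : a ∈ C.1 := self_mem_linkClass ha le_top
    let T : Finset (Fin (N + 1)) := Finset.univ.filter fun i => β C i ≤ x
    have hmap : T.map (β C) = covers ⊥ x := by
      ext y
      simp only [T, Finset.mem_map, Finset.mem_filter, Finset.mem_univ, true_and, mem_covers]
      constructor
      · rintro ⟨i, hi, rfl⟩
        exact ⟨(C.mem_covers (hβ C i)).1, hi⟩
      · rintro ⟨hy, hyx⟩
        have hyC : y ∈ C.1 := (C.mem_iff ht haC).2
          ⟨⟨hy, le_top⟩, h.linked_of_le_of_lt hA hN hr ha hy hax hyx hxtop⟩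
        have : β C (e C ⟨y, hyC⟩) = y := by simp [β]
        exact ⟨e C ⟨y, hyC⟩, by rwa [this], this⟩
    -- A proper element has as many atoms as its rank, which is less than `N + 1`.
    have hT : T ≠ ⊤ := fun hT => by
      have h1 := h.card_covers_of_lt hA hr bot_le hxtop
      have h2 := h.rank_lt hxtop
      rw [← hmap, Finset.card_map, hT] at h1
      have h3 : (⊤ : Finset (Fin (N + 1))).card = N + 1 := by simp
      omega
    exact ⟨C, T, h.eq_of_covers_eq hA hN hr bot_le le_top bot_le le_top
      ((hφcov C T hT).trans hmap)⟩

end Summation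

end IsCoverRegular

end FinPoset

/-! ### The butterfly case: gluing the link classes. -/

namespace FinPoset

theorem Butterfly.coe_le_coe_iff {n : ℕ} {p q : ButterflyCore (n - 1)} :
    (((p : WithTop (ButterflyCore (n - 1))) : Butterfly n) ≤
      ((q : WithTop (ButterflyCore (n - 1))) : Butterfly n)) ↔ p = q ∨ p.level < q.level := by
  rw [WithBot.coe_le_coe, WithTop.coe_le_coe]
  rfl

namespace IsCoverRegular

variable {P : Type*} [PartialOrder P] [BoundedOrder P] [Fintype P]
variable {ρ : P → ℕ} {A : ℕ → ℕ} (h : IsCoverRegular ρ A) {N : ℕ} (hN : 3 ≤ N)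
  (hr : ρ (⊤ : P) = ρ (⊥ : P) + (N + 1)) (hA : ∀ i, 2 ≤ i → i ≤ N → A i = 2)
include h hN hr hA

open scoped Classical in
/-- Above a link class, every level of the proper part has two elements. -/
theorem card_level_linkClass (C : LinkClass (⊥ : P) ⊤) (l : Fin N) :
    (Finset.univ.filter fun z : P => ρ z = ρ (⊥ : P) + (l + 1) ∧ ∃ a ∈ C.1, a ≤ z).card = 2 := by
  obtain ⟨C, a, ha, rfl⟩ := C
  rw [mem_covers] at ha
  have hra := h.rank_covBy ha.1
  -- The lowest level is the class itself. On higher levels, lying above some member of the class is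
  -- the same as lying above `a`, so the count takes place in `[a, ⊤]`.
  rcases Nat.eq_zero_or_pos l with hl | hl
  · rw [← h.butterfly_card_linked hA hN hr ha.1 ha.2]
    congr 1
    ext z
    rw [← linkClass]
    simp only [Finset.mem_filter, Finset.mem_univ, true_and, hl]
    constructor
    · rintro ⟨hz, b, hb, hbz⟩
      have hrb := h.rank_covBy (mem_linkClass.1 hb).1.1
      rwa [← h.eq_of_rank_le hbz (by omega)]
    · intro hz
      exact ⟨by rw [h.rank_covBy (mem_linkClass.1 hz).1.1], z, hz, le_rfl⟩
  · rw [← h.card_level_eq_two hA le_rfl ha.2 (by omega) hl l.2]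
    congr 1
    ext z
    simp only [Finset.mem_filter, Finset.mem_univ, true_and, mem_level]
    constructor
    · rintro ⟨hz, b, hb, hbz⟩
      rw [mem_linkClass] at hb
      exact ⟨h.le_of_linked hA hN hr hb.1.1 ha.1 hb.2.symm hbz le_top (by omega), le_top,
        by omega⟩
    · rintro ⟨haz, -, hz⟩
      exact ⟨by omega, a, self_mem_linkClass ha.1 ha.2, haz⟩

theorem exists_orderIso_kSum_butterfly :
    ∃ k : ℕ, 0 < k ∧ Nonempty (P ≃o KSum k (Butterfly (N + 1))) := by
  classical
  have ht : LinkTrans (⊥ : P) ⊤ :=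
    fun a b c ha hb hc => h.butterfly_linked_trans hA hN hr ha hb hc
  have hne := h.nonempty_linkClass hr
  let L (C : LinkClass (⊥ : P) ⊤) (l : Fin N) : Finset P :=
    Finset.univ.filter fun z : P => ρ z = ρ (⊥ : P) + (l + 1) ∧ ∃ a ∈ C.1, a ≤ z
  have hL : ∀ C l z, z ∈ L C l ↔ ρ z = ρ (⊥ : P) + (l + 1) ∧ ∃ a ∈ C.1, a ≤ z := by
    intro C l z
    simp [L]
  -- The labelling of each level is arbitrary: above one class, any element of a lower level lies
  -- below any element of a higher one.
  let σ (C : LinkClass (⊥ : P) ⊤) (l : Fin N) : L C l ≃ Fin 2 :=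
    (L C l).equivFinOfCardEq (h.card_level_linkClass hN hr hA C l)
  let ψ (C : LinkClass (⊥ : P) ⊤) (p : ButterflyCore N) : P := (σ C p.level).symm p.side
  have hψ (C p) : ρ (ψ C p) = ρ (⊥ : P) + (p.level + 1) ∧ ∃ a ∈ C.1, a ≤ ψ C p :=
    (hL _ _ _).1 ((σ C p.level).symm p.side).2
  have hψbot (C p) : ψ C p ≠ ⊥ := fun hb => by
    have := (hψ C p).1
    rw [hb] at this
    omega
  have hψtop (C p) : ψ C p < ⊤ := by
    refine lt_of_le_of_apply_lt (ρ := ρ) le_top ?_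
    have := (hψ C p).1
    have := p.level.2
    omega
  have hψle : ∀ C D p q, ψ C p ≤ ψ D q ↔ C = D ∧ (p = q ∨ p.level < q.level) := by
    intro C D p q
    obtain ⟨hp, a, haC, hap⟩ := hψ C p
    obtain ⟨hq, b, hbD, hbq⟩ := hψ D q
    have ha := C.mem_covers haC
    have hb := D.mem_covers hbD
    constructor
    · intro hle
      have hCD : C = D := C.eq_of_linked ht D haC hbD
        (h.butterfly_linked_of_le_of_lt hA hN hr ha.1 hb.1 (hap.trans hle) hbq (hψtop D q))
      subst hCD
      refine ⟨rfl, ?_⟩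
      have hrank := h.rank_le hle
      rcases lt_or_ge p.level q.level with hlt | hge
      · exact Or.inr hlt
      · left
        have hlev : p.level = q.level := le_antisymm (Fin.le_def.2 (by omega)) hge
        have heq := h.eq_of_rank_le hle (by rw [hp, hq, hlev])
        obtain ⟨l, s⟩ := p
        obtain ⟨l', s'⟩ := q
        dsimp only at hlev
        subst hlev
        have : s = s' := (σ C l).symm.injective (Subtype.ext heq)
        rw [this]
    · rintro ⟨rfl, rfl | hlt⟩
      · exact le_rfl
      rw [Fin.lt_def] at hlt
      have hl := ((C.mem_iff ht haC).1 hbD).2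
      have haq : a ≤ ψ C q := h.le_of_linked hA hN hr hb.1 ha.1 hl.symm hbq le_top (by omega)
      have hra := h.rank_covBy ha.1
      exact h.le_of_rank_lt hA le_rfl (u := a) (v := ⊤) (by omega) hap le_top haq le_top (by omega)
  let φ (C : LinkClass (⊥ : P) ⊤) : Butterfly (N + 1) → P :=
    WithBot.recBotCoe ⊥ (WithTop.recTopCoe ⊤ (ψ C))
  have hbt : (⊥ : P) ≠ ⊤ := fun hbt => by
    rw [hbt] at hr
    omega
  refine exists_orderIso_kSum φ (fun C D p q => ?_) fun x => ?_
  · induction p using WithBot.recBotCoe with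
    | bot => exact iff_of_true bot_le (Or.inl rfl)
    | coe p =>
      induction q using WithBot.recBotCoe with
      | bot =>
        induction p using WithTop.recTopCoe with
        | top =>
          refine iff_of_false (fun hle => hbt (top_le_iff.1 hle)) ?_
          rintro (hp | hq | ⟨-, hpq⟩)
          · exact WithBot.coe_ne_bot hp
          · exact WithBot.coe_ne_bot hq.symm
          · exact WithBot.coe_ne_bot (le_bot_iff.1 hpq)
        | coe p =>
          refine iff_of_false (fun hle => hψbot C p (le_bot_iff.1 hle)) ?_
          rintro (hp | hq | ⟨-, hpq⟩)
          · exact WithBot.coe_ne_bot hp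
          · exact WithBot.coe_ne_bot hq.symm
          · exact WithBot.coe_ne_bot (le_bot_iff.1 hpq)
      | coe q =>
        induction q using WithTop.recTopCoe with
        | top => exact iff_of_true le_top (Or.inr (Or.inl rfl))
        | coe q =>
          have hq : ((q : WithTop (ButterflyCore (N + 1 - 1))) : Butterfly (N + 1)) ≠ ⊤ := fun hq =>
            WithTop.coe_ne_top (WithBot.coe_injective hq)
          induction p using WithTop.recTopCoe with
          | top =>
            refine iff_of_false (fun hle => (hψtop D q).ne (top_le_iff.1 hle)) ?_
            rintro (hp | hq' | ⟨-, hpq⟩)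
            · exact WithBot.coe_ne_bot hp
            · exact hq hq'
            · exact hq (top_le_iff.1 hpq)
          | coe p =>
            refine (hψle C D p q).trans ?_
            rw [or_iff_right WithBot.coe_ne_bot, or_iff_right hq]
            exact and_congr_right fun _ => (Butterfly.coe_le_coe_iff (n := N + 1)).symm
  · rcases eq_or_lt_of_le (le_top : x ≤ ⊤) with rfl | hxtop
    · exact ⟨hne.some, ((⊤ : WithTop (ButterflyCore (N + 1 - 1))) : Butterfly (N + 1)), rfl⟩
    rcases eq_or_lt_of_le (bot_le : ⊥ ≤ x) with rfl | hxbot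
    · exact ⟨hne.some, ⊥, rfl⟩
    obtain ⟨a, ha, hax⟩ := exists_covBy_le_of_lt hxbot
    let C : LinkClass (⊥ : P) ⊤ := ⟨linkClass ⊥ ⊤ a, a, by simp [ha], rfl⟩
    have haC : a ∈ C.1 := self_mem_linkClass ha le_top
    have h1 := h.rank_lt hxtop
    have h2 := h.rank_lt hxbot
    -- Level `l` of the core holds the elements of rank `l + 1` above `⊥`.
    let l : Fin N := ⟨ρ x - ρ (⊥ : P) - 1, by omega⟩
    have hxL : x ∈ L C l := (hL C l x).2 ⟨by simp only [l]; omega, a, haC, hax⟩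
    refine ⟨C, (((⟨l, σ C l ⟨x, hxL⟩⟩ : ButterflyCore (N + 1 - 1)) :
      WithTop (ButterflyCore (N + 1 - 1))) : Butterfly (N + 1)), ?_⟩
    change ((σ C l).symm (σ C l ⟨x, hxL⟩) : P) = x
    rw [Equiv.symm_apply_apply]

end IsCoverRegular

end FinPoset

theorem theorem3p7 {P : Type*} [PartialOrder P] [BoundedOrder P] [Finite P]
    (hB : FinPoset.IsBinomial P) (hE : FinPoset.IsEulerian P)
    (n m : ℕ) (hnm : n = 2 * m + 1) (hn : 5 ≤ n) (hrank : FinPoset.HasRank P n) :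
    (∃ k : ℕ, 0 < k ∧ Nonempty (P ≃o FinPoset.KSum k (FinPoset.BooleanLattice n))) ∨
      (∃ k : ℕ, 0 < k ∧ Nonempty (P ≃o FinPoset.KSum k (FinPoset.Butterfly n))) := by
  have := Fintype.ofFinite P
  obtain ⟨A, h⟩ := hB.exists_isCoverRegular hE
  subst hnm
  have hr : FinPoset.rk (⊤ : P) = FinPoset.rk (⊥ : P) + (2 * m + 1) := by
    rw [FinPoset.rk_top hB hrank, FinPoset.rk_bot, zero_add]
  rcases h.A_boolean_or_butterfly (by omega) bot_le hr with hA | hA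
  · exact Or.inl (h.exists_orderIso_kSum_boolean (by omega) hr hA)
  · exact Or.inr (h.exists_orderIso_kSum_butterfly (by omega) hr hA)
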